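/- Let $\Bbbk$ be a field, $A=\Bbbk[z_1,\ldots,z_m]$ and $R=A[x_0,\ldots,x_r]$ polynomial rings, with $R$ standard graded over $A$. Let $\alpha_1,\ldots,\alpha_m\in\Bbbk$, $\mathfrak n=(z_1-\alpha_1,\ldots,z_m-\alpha_m)\subset A$, and view $\Bbbk\simeq A/\mathfrak n$ as an $A$-module. Let $g_0,\ldots,g_s\in R$ be forms of the same degree $d>0$, $\mathcal I=(g_0,\ldots,g_s)\subset R$, and let $I=(\mathcal I,\mathfrak n)/\mathfrak n\subset R/\mathfrak nR\simeq\Bbbk[x_0,\ldots,x_r]$ be the ideal generated by the images of the $g_i$; assume $I\neq 0$. For an ideal $J$ of a ring $S$ let $\mathcal R_S(J)=S[Jt]=\bigoplus_{n\ge 0}J^nt^n\subset S[t]$ be the Rees algebra and $\mathrm{gr}_J(S)=\mathcal R_S(J)/J\mathcal R_S(J)$ the associated graded ring; if $S$ is local with maximal ideal $\mathfrak m$, the analytic spread $\ell(J)$ is the Krull dimension of $\mathcal R_S(J)/\mathfrak m\mathcal R_S(J)$. Set $T=\mathcal R_R(\mathcal I)\otimes_A\Bbbk$ and $G=\mathrm{gr}_{\mathcal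 I}(R)\otimes_A\Bbbk$, and let $\mathfrak s:T\twoheadrightarrow\mathcal R_{R/\mathfrak nR}(I)$ be the natural map given by reducing coefficients modulo $\mathfrak nR$. Both algebras are bigraded, with $[\mathcal R_R(\mathcal I)]_{c,n}=[\mathcal I^n]_{c+nd}\,t^n$, the induced bigrading on $T$, and $[\mathcal R_{R/\mathfrak nR}(I)]_{c,n}=[I^n]_{c+nd}\,t^n$. The dimension of the zero ring or of the zero module is $-\infty$, and the dimension of a module is that of its support. 1. The ideal $\ker(\mathfrak s)$ is a minimal prime of $T$. The natural map $T\to G$ induces an isomorphism $T/\mathcal I T\simeq G$, every minimal prime $\mathfrak Q\neq\ker(\mathfrak s)$ of $T$ is the preimage of a minimal prime of $G$, and $\dim(T/\mathfrak Q)\le\dim(G)$ for each such $\mathfrak Q$. Moreover, $$\dim(T)=\max\{r+2,\ \dim(G)\}.$$ 2. Let $k\ge 0$ be an integer such that $\ell(\mathcal I_{\mathfrak P})\le\mathrm{ht}(\mathfrak P/\mathfrak nR)+k$ for every prime $\mathfrak P\subset R$ containing $(\mathcal I,\mathfrak n)$, where $\mathcal I_{\mathfrak P}=\mathcal I R_{\mathfrak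 P}$. Then $$\dim(G)\le\dim(R/\mathfrak nR)+k\qquad\text{and}\qquad \dim(T)\le\max\{r+2,\ r+k+1\}.$$ 3. $\dim(\ker(\mathfrak s))\le\dim(G)$, where $\ker(\mathfrak s)$ is viewed as a $T$-module. 4. The prime $P=\ker(\mathfrak s)$ belongs to $\mathrm{BiProj}(T)$, that is, it is bihomogeneous and does not contain the irrelevant ideal $([T]_{1,0})\cap([T]_{0,1})$. For a bigraded $T$-module $M$ let $M_{(P)}$ be the $T_{(P)}$-module of fractions $m/g$ with $m\in M$ and $g\in T\setminus P$ bihomogeneous of the same bidegree. Then $\mathfrak s$ induces an isomorphism of $T_{(P)}$-modules $$T_{(P)}\xrightarrow{\ \simeq\ }\bigl(\mathcal R_{R/\mathfrak nR}(I)\bigr)_{(P)},\qquad \frac{a}{b}\longmapsto\frac{\mathfrak s(a)}{b},$$ where the right-hand side is a localization as a $T$-module through $\mathfrak s$. -/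

import Mathlib

open scoped TensorProduct

/-! ### Blowup algebras -/

section Blowup

/-- The associated graded ring `gr_J(R) = R[Jt] / J R[Jt]`. -/
def AssocGradedRing {R : Type*} [CommRing R] (J : Ideal R) : Type _ :=
  reesAlgebra J ⧸ J.map (algebraMap R (reesAlgebra J))

noncomputable instance {R : Type*} [CommRing R] (J : Ideal R) : CommRing (AssocGradedRing J) :=
  Ideal.Quotient.commRing (J.map (algebraMap R (reesAlgebra J)))

noncomputable instance {A R : Type*} [CommRing A] [CommRing R] [Algebra A R] (J : Ideal R) :
    Algebra A (AssocGradedRing J) :=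
  Ideal.instAlgebraQuotient A (J.map (algebraMap R (reesAlgebra J)))

/-- The quotient map `R[Jt] → gr_J(R)`. -/
noncomputable def reesToAssocGraded (A : Type*) {R : Type*} [CommRing A] [CommRing R] [Algebra A R]
    (J : Ideal R) : reesAlgebra J →ₐ[A] AssocGradedRing J :=
  Ideal.Quotient.mkₐ A (J.map (algebraMap R (reesAlgebra J)))

/-- The fiber cone `R[Jt] / 𝔪 R[Jt]` of an ideal of a local ring `(R, 𝔪)`. -/
abbrev FiberCone {R : Type*} [CommRing R] [IsLocalRing R] (J : Ideal R) : Type _ :=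
  reesAlgebra J ⧸ (IsLocalRing.maximalIdeal R).map (algebraMap R (reesAlgebra J))

/-- The analytic spread of an ideal of a local ring: the Krull dimension of its fiber cone. -/
noncomputable def analyticSpread {R : Type*} [CommRing R] [IsLocalRing R] (J : Ideal R) :
    WithBot ℕ∞ :=
  ringKrullDim (FiberCone J)

end Blowup

/-! ### Specialization of Rees algebras along an ideal of the base ring -/

section Specialization

variable {A R : Type*} [CommRing A] [CommRing R] [Algebra A R]

/-- The extended ideal `𝔫R`. -/
abbrev extendedIdeal (R : Type*) [CommRing R] [Algebra A R] (n : Ideal A) : Ideal R :=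
  n.map (algebraMap A R)

/-- The ideal `(J, 𝔫)/𝔫` of `R / 𝔫R`. -/
abbrev specializedIdeal (n : Ideal A) (J : Ideal R) : Ideal (R ⧸ extendedIdeal R n) :=
  J.map (Ideal.Quotient.mk (extendedIdeal R n))

/-- `R[Jt] ⊗_A A/𝔫`. -/
abbrev ReesTensor (n : Ideal A) (J : Ideal R) : Type _ :=
  (A ⧸ n) ⊗[A] reesAlgebra J

/-- `gr_J(R) ⊗_A A/𝔫`. -/
abbrev AssocGradedTensor (n : Ideal A) (J : Ideal R) : Type _ :=
  (A ⧸ n) ⊗[A] AssocGradedRing J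

noncomputable instance (n : Ideal A) (J : Ideal R) : CommRing (ReesTensor n J) :=
  inferInstance

noncomputable instance (n : Ideal A) (J : Ideal R) : Algebra A (ReesTensor n J) :=
  inferInstance

noncomputable instance (n : Ideal A) (J : Ideal R) : CommRing (AssocGradedTensor n J) :=
  inferInstance

noncomputable instance (n : Ideal A) (J : Ideal R) : Algebra A (AssocGradedTensor n J) :=
  inferInstance

/-- The natural surjection `R[Jt] ⊗_A A/𝔫 → gr_J(R) ⊗_A A/𝔫`. -/
noncomputable def reesTensorToAssocGraded (n : Ideal A) (J : Ideal R) :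
    ReesTensor n J →ₐ[A] AssocGradedTensor n J :=
  Algebra.TensorProduct.map (AlgHom.id A (A ⧸ n))
    (reesToAssocGraded A J)

/-- The extension of `J` to `R[Jt] ⊗_A A/𝔫`. -/
noncomputable abbrev extensionToReesTensor (n : Ideal A) (J : Ideal R) :
    Ideal (ReesTensor n J) :=
  (J.map (algebraMap R (reesAlgebra J))).map
    (Algebra.TensorProduct.includeRight : reesAlgebra J →ₐ[A] ReesTensor n J)

/-- Reduction of coefficients modulo `𝔫R`, as a map `R[Jt] → (R/𝔫R)[It]`. -/
noncomputable def reesReduction (n : Ideal A) (J : Ideal R) :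
    reesAlgebra J →ₐ[A] reesAlgebra (specializedIdeal n J) :=
  AlgHom.codRestrict
    ((Polynomial.mapAlgHom (Ideal.Quotient.mkₐ A (extendedIdeal R n))).comp
      ((reesAlgebra J).val.restrictScalars A))
    ((reesAlgebra (specializedIdeal n J)).restrictScalars A)
    (by
      intro x i
      have h := Ideal.mem_map_of_mem (Ideal.Quotient.mk (extendedIdeal R n)) (x.2 i)
      rw [Ideal.map_pow] at h
      simpa [Polynomial.coeff_map] using h)

theorem coe_reesReduction (n : Ideal A) (J : Ideal R) (x : reesAlgebra J) :
    ((reesReduction n J x : reesAlgebra (specializedIdeal n J)) :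
        Polynomial (R ⧸ extendedIdeal R n)) =
      (x : Polynomial R).map (Ideal.Quotient.mk (extendedIdeal R n)) :=
  rfl

theorem algebraMap_reesAlgebra_eq_zero (n : Ideal A) (J : Ideal R) (a : A) (ha : a ∈ n) :
    algebraMap A (reesAlgebra (specializedIdeal n J)) a = 0 := by
  apply Subtype.ext
  change algebraMap A (Polynomial (R ⧸ extendedIdeal R n)) a = 0
  rw [IsScalarTower.algebraMap_apply A (R ⧸ extendedIdeal R n),
    IsScalarTower.algebraMap_apply A R (R ⧸ extendedIdeal R n)]
  have h : algebraMap R (R ⧸ extendedIdeal R n) (algebraMap A R a) = 0 :=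
    Ideal.Quotient.eq_zero_iff_mem.mpr (Ideal.mem_map_of_mem _ ha)
  rw [h, map_zero]

/-- The specialization map `𝔰 : R[Jt] ⊗_A A/𝔫 → (R/𝔫R)[It]`, `I = (J, 𝔫)/𝔫`. -/
noncomputable def specializationMap (n : Ideal A) (J : Ideal R) :
    ReesTensor n J →ₐ[A] reesAlgebra (specializedIdeal n J) :=
  Algebra.TensorProduct.lift
    (Ideal.Quotient.liftₐ n (Algebra.ofId A (reesAlgebra (specializedIdeal n J)))
      (algebraMap_reesAlgebra_eq_zero n J))
    (reesReduction n J) (fun _ _ => Commute.all _ _)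

theorem specializationMap_tmul (n : Ideal A) (J : Ideal R) (a : A) (x : reesAlgebra J) :
    specializationMap n J (Ideal.Quotient.mk n a ⊗ₜ[A] x) = a • reesReduction n J x := by
  rw [specializationMap, Algebra.TensorProduct.lift_tmul, Algebra.smul_def]
  rfl

/-- The kernel of the specialization map. -/
noncomputable abbrev specializationKer (n : Ideal A) (J : Ideal R) : Ideal (ReesTensor n J) :=
  RingHom.ker (specializationMap n J)

/-- `(R/𝔫R)[It]` as an algebra over `R[Jt] ⊗_A A/𝔫` through the specialization map. -/
noncomputable instance specializationAlgebra (n : Ideal A) (J : Ideal R) :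
    Algebra (ReesTensor n J) (reesAlgebra (specializedIdeal n J)) :=
  (specializationMap n J).toRingHom.toAlgebra

end Specialization

/-! ### Bigradings on Rees algebras -/

section Bigrading

variable {A R : Type*} [CommRing A] [CommRing R] [Algebra A R]

/-- For a graded ring `R` and `bideg t = (-d, 1)`, the bihomogeneous piece
`[R[Jt]]_{c,e} = [J ^ e]_{c + e d} t ^ e`. -/
def reesBigrading (𝒜 : ℕ → Submodule A R) (J : Ideal R) (d : ℕ) (i : ℕ × ℕ) :
    Submodule A (reesAlgebra J) where
  carrier := {x | ∃ f ∈ 𝒜 (i.1 + i.2 * d), (x : Polynomial R) = Polynomial.monomial i.2 f}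
  add_mem' := by
    rintro x y ⟨f, hf, hx⟩ ⟨g, hg, hy⟩
    exact ⟨f + g, add_mem hf hg, by simp [hx, hy]⟩
  zero_mem' := ⟨0, zero_mem _, by simp⟩
  smul_mem' := by
    rintro a x ⟨f, hf, hx⟩
    refine ⟨a • f, Submodule.smul_mem _ _ hf, ?_⟩
    rw [← Polynomial.smul_monomial, ← hx]
    rfl

theorem reesBigrading_mul_mem (𝒜 : ℕ → Submodule A R) [SetLike.GradedMonoid 𝒜] (J : Ideal R)
    (d : ℕ) {i j : ℕ × ℕ} {x y : reesAlgebra J} (hx : x ∈ reesBigrading 𝒜 J d i)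
    (hy : y ∈ reesBigrading 𝒜 J d j) : x * y ∈ reesBigrading 𝒜 J d (i + j) := by
  obtain ⟨f, hf, hx⟩ := hx
  obtain ⟨g, hg, hy⟩ := hy
  refine ⟨f * g, ?_, ?_⟩
  · have h := SetLike.mul_mem_graded hf hg
    have e : i.1 + i.2 * d + (j.1 + j.2 * d) = (i + j).1 + (i + j).2 * d := by
      simp only [Prod.fst_add, Prod.snd_add]; ring
    rwa [e] at h
  · rw [MulMemClass.coe_mul, hx, hy, Polynomial.monomial_mul_monomial, Prod.snd_add]

theorem decompose_eq_zero_of_mem_span (𝒜 : ℕ → Submodule A R) [GradedAlgebra 𝒜] {e : ℕ}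
    {S : Set R} (hS : S ⊆ 𝒜 e) {x : R} (hx : x ∈ Ideal.span S) {i : ℕ} (hi : i < e) :
    ((DirectSum.decompose 𝒜 x) i : R) = 0 := by
  induction hx using Submodule.span_induction with
  | mem x h => exact DirectSum.decompose_of_mem_ne 𝒜 (hS h) hi.ne'
  | zero => simp
  | add x y _ _ hx hy => simp [hx, hy]
  | smul a x hx ih =>
    clear ih
    induction hx using Submodule.span_induction generalizing a with
    | mem x h =>
      rw [smul_eq_mul]
      exact DirectSum.coe_decompose_mul_of_right_mem_of_not_le 𝒜 (hS h) (not_le.mpr hi)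
    | zero => simp
    | add x y _ _ hx hy =>
      rw [smul_add, DirectSum.decompose_add, DirectSum.add_apply, Submodule.coe_add, hx, hy,
        add_zero]
    | smul b x _ hx => rw [smul_smul]; exact hx _

theorem pow_subset_graded (𝒜 : ℕ → Submodule A R) [GradedAlgebra 𝒜] {d : ℕ}
    {S : Set R} (hS : S ⊆ 𝒜 d) (n : ℕ) : ∃ S' : Set R, S' ⊆ 𝒜 (n * d) ∧
      Ideal.span S ^ n = Ideal.span S' := by
  induction n with
  | zero => exact ⟨{1}, by simpa using SetLike.one_mem_graded 𝒜, by simp⟩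
  | succ n ih =>
    obtain ⟨S', hS', h⟩ := ih
    open scoped Pointwise in
    refine ⟨S' * S, ?_, ?_⟩
    · rintro _ ⟨a, ha, b, hb, rfl⟩
      have := SetLike.mul_mem_graded (hS' ha) (hS hb)
      rwa [show n * d + d = (n + 1) * d by ring] at this
    · rw [pow_succ, h, Ideal.span_mul_span']

/-- The bigrading on the Rees algebra of an ideal generated by forms of degree `d`. -/
@[reducible] noncomputable def reesBigradingGradedAlgebra (𝒜 : ℕ → Submodule A R) [GradedAlgebra 𝒜]
    (d : ℕ) (S : Set R) (hS : S ⊆ 𝒜 d) :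
    GradedAlgebra (reesBigrading 𝒜 (Ideal.span S) d) :=
  { one_mem := ⟨1, by simpa using SetLike.one_mem_graded 𝒜, by simp⟩
    mul_mem := fun _ _ _ _ hx hy => reesBigrading_mul_mem 𝒜 _ d hx hy
    toDecomposition := DirectSum.IsInternal.chooseDecomposition _ (by
      classical
      apply DirectSum.isInternal_submodule_of_iSupIndep_of_iSup_eq_top
      · rw [iSupIndep_def]
        intro i
        rw [Submodule.disjoint_def]
        intro x hx hx'
        have key : ((⨆ j, ⨆ (_ : j ≠ i), reesBigrading 𝒜 (Ideal.span S) d j)) ≤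
            LinearMap.ker ((GradedAlgebra.proj 𝒜 (i.1 + i.2 * d)) ∘ₗ
              ((Polynomial.lcoeff R i.2).restrictScalars A) ∘ₗ
              ((reesAlgebra (Ideal.span S)).val.toLinearMap.restrictScalars A)) := by
          refine iSup₂_le fun j hj y hy => ?_
          obtain ⟨f, hf, hy⟩ := hy
          rw [LinearMap.mem_ker]
          change GradedAlgebra.proj 𝒜 (i.1 + i.2 * d) ((y : Polynomial R).coeff i.2) = 0
          rw [hy, Polynomial.coeff_monomial]
          split_ifs with h
          · rw [GradedAlgebra.proj_apply]
            apply DirectSum.decompose_of_mem_ne 𝒜 hf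
            intro h'
            rw [h] at h'
            exact hj (Prod.ext (by omega) h)
          · simp
        have h0 := key hx'
        rw [LinearMap.mem_ker] at h0
        change GradedAlgebra.proj 𝒜 (i.1 + i.2 * d) ((x : Polynomial R).coeff i.2) = 0 at h0
        obtain ⟨f, hf, hx⟩ := hx
        rw [hx, Polynomial.coeff_monomial, if_pos rfl, GradedAlgebra.proj_apply,
          DirectSum.decompose_of_mem_same 𝒜 hf] at h0
        apply Subtype.ext
        rw [hx, h0]
        simp
      · rw [eq_top_iff]
        rintro ⟨p, hp⟩ -
        have hterm : ∀ n, ∀ f : R, f ∈ Ideal.span S ^ n →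
            ∀ h : Polynomial.monomial n f ∈ reesAlgebra (Ideal.span S),
            (⟨Polynomial.monomial n f, h⟩ : reesAlgebra (Ideal.span S)) ∈
              ⨆ i, reesBigrading 𝒜 (Ideal.span S) d i := by
          intro n f hf h
          obtain ⟨S', hS', hpow⟩ := pow_subset_graded 𝒜 hS n
          have hhom : (Ideal.span S ^ n).IsHomogeneous 𝒜 := by
            rw [hpow]
            exact Ideal.homogeneous_span 𝒜 S' fun x hx => ⟨_, hS' hx⟩
          have hmem : ∀ i, Polynomial.monomial n ((DirectSum.decompose 𝒜 f i : 𝒜 i) : R) ∈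
              reesAlgebra (Ideal.span S) :=
            fun i => reesAlgebra.monomial_mem.mpr (hhom i hf)
          have hsum : (⟨Polynomial.monomial n f, h⟩ : reesAlgebra (Ideal.span S)) =
              ∑ i ∈ (DirectSum.decompose 𝒜 f).support,
                (⟨Polynomial.monomial n ((DirectSum.decompose 𝒜 f i : 𝒜 i) : R), hmem i⟩ :
                  reesAlgebra (Ideal.span S)) := by
            apply Subtype.ext
            rw [AddSubmonoidClass.coe_finsetSum]
            simp only
            rw [← map_sum, DirectSum.sum_support_decompose 𝒜 f]
          rw [hsum]
          refine Submodule.sum_mem _ fun i _ => ?_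
          by_cases hi : i < n * d
          · have hz : ((DirectSum.decompose 𝒜 f i : 𝒜 i) : R) = 0 :=
              decompose_eq_zero_of_mem_span 𝒜 hS' (hpow ▸ hf) hi
            have : (⟨Polynomial.monomial n ((DirectSum.decompose 𝒜 f i : 𝒜 i) : R), hmem i⟩ :
                reesAlgebra (Ideal.span S)) = 0 := by
              apply Subtype.ext
              simp [hz]
            rw [this]
            exact zero_mem _
          · refine Submodule.mem_iSup_of_mem (i - n * d, n) ⟨_, ?_, rfl⟩
            simp only
            rw [Nat.sub_add_cancel (not_lt.mp hi)]
            exact SetLike.coe_mem _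
        have hsum : (⟨p, hp⟩ : reesAlgebra (Ideal.span S)) = ∑ n ∈ p.support,
            ⟨Polynomial.monomial n (p.coeff n), reesAlgebra.monomial_mem.mpr (hp n)⟩ := by
          apply Subtype.ext
          rw [AddSubmonoidClass.coe_finsetSum]
          exact p.as_sum_support
        rw [hsum]
        exact Submodule.sum_mem _ fun n _ => hterm n _ (hp n) _) }

end Bigrading

/-! ### Homogeneous localization of graded modules -/

section HomogeneousLocalization

variable {ι σ T M τ : Type*} [CommRing T] [AddCommGroup M] [Module T M]
  [SetLike σ T] [AddSubgroupClass σ T] [AddCommMonoid ι] [DecidableEq ι]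
  (𝒯 : ι → σ) [GradedRing 𝒯]

/-- `M_P` as a module over the ring `T_(P)` of fractions of degree zero. -/
noncomputable instance homogeneousLocalizationModule (P : Ideal T) [P.IsPrime] :
    Module (HomogeneousLocalization.AtPrime 𝒯 P) (LocalizedModule P.primeCompl M) :=
  Module.compHom _ (algebraMap (HomogeneousLocalization.AtPrime 𝒯 P) (Localization P.primeCompl))

theorem homogeneousLocalization_smul_def (P : Ideal T) [P.IsPrime]
    (c : HomogeneousLocalization.AtPrime 𝒯 P) (x : LocalizedModule P.primeCompl M) :
    c • x = c.val • x :=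
  rfl

/-- For a graded `T`-module `M`, the `T_(P)`-module
`M_(P) = {m / g | m ∈ M and g ∈ T \ P homogeneous of the same degree}`. -/
def moduleHomogeneousLocalization [SetLike τ M] [AddSubgroupClass τ M] (ℳ : ι → τ)
    [SetLike.GradedSMul 𝒯 ℳ] (P : Ideal T) [P.IsPrime] :
    Submodule (HomogeneousLocalization.AtPrime 𝒯 P) (LocalizedModule P.primeCompl M) where
  carrier := {x | ∃ (i : ι) (m : M) (g : P.primeCompl),
    m ∈ ℳ i ∧ (g : T) ∈ 𝒯 i ∧ x = LocalizedModule.mk m g}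
  add_mem' := by
    rintro _ _ ⟨i, m, g, hm, hg, rfl⟩ ⟨j, m', g', hm', hg', rfl⟩
    refine ⟨i + j, g' • m + g • m', g * g', ?_, SetLike.mul_mem_graded hg hg', ?_⟩
    · refine add_mem ?_ (SetLike.GradedSMul.smul_mem hg hm')
      rw [add_comm]
      exact SetLike.GradedSMul.smul_mem hg' hm
    · rw [LocalizedModule.mk_add_mk]
  zero_mem' := ⟨0, 0, 1, zero_mem _, SetLike.one_mem_graded 𝒯, by simp⟩
  smul_mem' := by
    rintro c _ ⟨i, m, g, hm, hg, rfl⟩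
    obtain ⟨y, rfl⟩ := HomogeneousLocalization.mk_surjective c
    refine ⟨y.deg + i, (y.num : T) • m, ⟨y.den, y.den_mem⟩ * g,
      SetLike.GradedSMul.smul_mem y.num.2 hm, SetLike.mul_mem_graded y.den.2 hg, ?_⟩
    rw [homogeneousLocalization_smul_def, HomogeneousLocalization.val_mk,
      LocalizedModule.mk_smul_mk]

/-- Membership of an ideal in `BiProj T`: a bihomogeneous prime not containing the irrelevant
ideal `([T]_{1,0}) ∩ ([T]_{0,1})`. -/
def IsBiProjPoint (𝒯 : ℕ × ℕ → σ) [GradedRing 𝒯] (P : Ideal T) : Prop :=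
  P.IsPrime ∧ P.IsHomogeneous 𝒯 ∧
    ¬ Ideal.span (𝒯 (1, 0) : Set T) ⊓ Ideal.span (𝒯 (0, 1) : Set T) ≤ P

end HomogeneousLocalization

/-! ### The polynomial setting -/

section Setup

variable {k : Type*} [Field k] {m r s d : ℕ}

/-- `A = k[z_1, …, z_m]`. -/
abbrev CoeffRing (k : Type*) [Field k] (m : ℕ) : Type _ := MvPolynomial (Fin m) k

/-- `R = A[x_0, …, x_r]`, graded over `A`. -/
abbrev SourceRing (k : Type*) [Field k] (m r : ℕ) : Type _ :=
  MvPolynomial (Fin (r + 1)) (CoeffRing k m)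

/-- The maximal ideal `𝔫 = (z_1 - α_1, …, z_m - α_m)` of `A`. -/
noncomputable def pointIdeal (α : Fin m → k) : Ideal (CoeffRing k m) :=
  Ideal.span (Set.range fun i => MvPolynomial.X i - MvPolynomial.C (α i))

/-- The forms of degree `d` in `R`. -/
abbrev Forms (k : Type*) [Field k] (m r d : ℕ) : Type _ :=
  MvPolynomial.homogeneousSubmodule (Fin (r + 1)) (CoeffRing k m) d

/-- The ideal `𝓘 = (g_0, …, g_s)` of `R`. -/
noncomputable def formsIdeal (g : Fin (s + 1) → Forms k m r d) : Ideal (SourceRing k m r) :=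
  Ideal.span (Set.range fun i => (g i : SourceRing k m r))

/-- The grading of `R` over `A`. -/
noncomputable abbrev sourceGrading (k : Type*) [Field k] (m r : ℕ) :
    ℕ → Submodule (CoeffRing k m) (SourceRing k m r) :=
  MvPolynomial.homogeneousSubmodule (Fin (r + 1)) (CoeffRing k m)

/-- The induced grading of `R / 𝔫R`. -/
noncomputable def specializedGrading (r : ℕ) (n : Ideal (CoeffRing k m)) (i : ℕ) :
    Submodule (CoeffRing k m) (SourceRing k m r ⧸ extendedIdeal (SourceRing k m r) n) :=
  (sourceGrading k m r i).map
    (Ideal.Quotient.mkₐ (CoeffRing k m) (extendedIdeal (SourceRing k m r) n)).toLinearMap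

noncomputable instance sourceGrading_gradedAlgebra (k : Type*) [Field k] (m r : ℕ) :
    GradedAlgebra (sourceGrading k m r) :=
  MvPolynomial.gradedAlgebra

instance specializedGrading_gradedMonoid (n : Ideal (CoeffRing k m)) :
    SetLike.GradedMonoid (specializedGrading r n) where
  one_mem := ⟨1, SetLike.one_mem_graded (sourceGrading k m r), rfl⟩
  mul_mem := by
    rintro i j _ _ ⟨x, hx, rfl⟩ ⟨y, hy, rfl⟩
    exact ⟨x * y, SetLike.mul_mem_graded (A := sourceGrading k m r) hx hy, rfl⟩

noncomputable instance formsIdeal_gradedAlgebra (g : Fin (s + 1) → Forms k m r d) :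
    GradedAlgebra (reesBigrading (sourceGrading k m r) (formsIdeal g) d) :=
  reesBigradingGradedAlgebra (sourceGrading k m r) d _ (by rintro _ ⟨i, rfl⟩; exact (g i).2)

/-- The bigrading of `R[𝓘t] ⊗_A A/𝔫`. -/
noncomputable abbrev reesTensorBigrading (n : Ideal (CoeffRing k m))
    (g : Fin (s + 1) → Forms k m r d) (i : ℕ × ℕ) :
    Submodule (CoeffRing k m ⧸ n) (ReesTensor n (formsIdeal g)) :=
  (reesBigrading (sourceGrading k m r) (formsIdeal g) d i).baseChange (CoeffRing k m ⧸ n)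

/-- The bigrading of `(R/𝔫R)[It]`. -/
noncomputable abbrev specializedReesBigrading (n : Ideal (CoeffRing k m))
    (g : Fin (s + 1) → Forms k m r d) (i : ℕ × ℕ) :
    Submodule (CoeffRing k m) (reesAlgebra (specializedIdeal n (formsIdeal g))) :=
  reesBigrading (specializedGrading r n) (specializedIdeal n (formsIdeal g)) d i

theorem specializationMap_mem (n : Ideal (CoeffRing k m)) (g : Fin (s + 1) → Forms k m r d)
    {i : ℕ × ℕ} {x : ReesTensor n (formsIdeal g)} (hx : x ∈ reesTensorBigrading n g i) :
    specializationMap n (formsIdeal g) x ∈ specializedReesBigrading n g i := by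
  rw [reesTensorBigrading, Submodule.baseChange_eq_span] at hx
  induction hx using Submodule.span_induction with
  | mem x h =>
    obtain ⟨y, ⟨f, hf, hy⟩, rfl⟩ := h
    change specializationMap n (formsIdeal g) (Ideal.Quotient.mk n 1 ⊗ₜ[CoeffRing k m] y) ∈ _
    rw [specializationMap_tmul, one_smul]
    refine ⟨_, ⟨f, hf, rfl⟩, ?_⟩
    rw [coe_reesReduction, hy, Polynomial.map_monomial]
    rfl
  | zero => rw [map_zero]; exact zero_mem _
  | add x y _ _ hx hy => rw [map_add]; exact add_mem hx hy
  | smul a x _ hx =>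
    obtain ⟨a, rfl⟩ := Ideal.Quotient.mk_surjective a
    have : Ideal.Quotient.mk n a • x = a • x :=
      (algebraMap_smul (CoeffRing k m ⧸ n) a x)
    rw [this, map_smul]
    exact Submodule.smul_mem _ _ hx

instance specializedRees_gradedSMul (n : Ideal (CoeffRing k m))
    (g : Fin (s + 1) → Forms k m r d) :
    SetLike.GradedSMul (reesTensorBigrading n g) (specializedReesBigrading n g) where
  smul_mem := by
    intro i j x y hx hy
    change specializationMap n (formsIdeal g) x * y ∈ _
    exact reesBigrading_mul_mem _ _ d (specializationMap_mem n g hx) hy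

end Setup

/-!
Write `T = R[𝓘t] ⊗_A A/𝔫`, `G = gr_𝓘(R) ⊗_A A/𝔫` and `B = R/𝔫R`.

The basic fact is that the kernel of the specialization map `𝔰 : T → B[It]` is `𝓘`-power torsion
(`toReesTensor_pow_mul_eq_zero`). Hence a prime of `T` that does not contain `𝓘T` contains
`ker 𝔰`. Since `B[It]` is a domain and `I ≠ 0`, the ideal `ker 𝔰` is a prime that does not contain
`𝓘T`, so it is a minimal prime, and every other minimal prime contains `𝓘T`. As `T/𝓘T ≃ G` by right
exactness of the tensor product, these other minimal primes come from `G`, the support of `ker 𝔰`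
lies in `Spec G`, and `dim T` is the maximum of `dim B[It]` and `dim G`. Here `dim B[It] = r + 2`,
because the transcendence degree of `B[It]` over `B` is one and the dimension of an affine domain
is its transcendence degree (`exists_trdeg_eq_ringKrullDim`, `ringKrullDim_reesAlgebra`).

For the bound on `dim G`, let `D` be the quotient of `G` by a minimal prime and `P` the contraction
of that prime to `R`, so that `P` contains `(𝓘, 𝔫)`. Over the generic point of `R/P`, the domain
`D` is a quotient of the fiber cone of `𝓘_P`, and additivity of the transcendence degree gives
`dim D ≤ dim R/P + ℓ(𝓘_P)` (`ringKrullDim_le_add_analyticSpread`). With the hypothesis on `ℓ(𝓘_P)`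
and `dim R/P + ht (P/𝔫R) ≤ dim B` the bound follows.

Localized homogeneously at `P = ker 𝔰`, the map `𝔰` is injective because its kernel is torsion with
respect to an element of `𝓘` outside `P`, and surjective because `𝔰` is surjective in each bidegree
(`exists_homogeneousLocalization_equiv`, `exists_mem_reesTensorBigrading`).
-/

universe u

/-! ### Krull dimension and transcendence degree -/

open Order in
/-- An injective integral extension preserves Krull dimension: chains of primes lift by lying over
and going up, and contract to strict chains by incomparability. -/
theorem ringKrullDim_eq_of_isIntegral {R S : Type*} [CommRing R] [CommRing S] [Algebra R S]
    [Algebra.IsIntegral R S] [FaithfulSMul R S] : ringKrullDim R = ringKrullDim S := by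
  apply le_antisymm
  · refine iSup_le fun l => ?_
    obtain ⟨P, -, hP, hPl⟩ := Ideal.exists_ideal_over_prime_of_isIntegral
      (S := S) l.head.asIdeal ⊥ (by
        rw [← RingHom.ker_eq_comap_bot,
          (RingHom.injective_iff_ker_eq_bot _).mp (FaithfulSMul.algebraMap_injective R S)]
        exact bot_le)
    have : P.LiesOver l.head.asIdeal := ⟨hPl.symm⟩
    obtain ⟨L, hL, -, -⟩ := Ideal.exists_ltSeries_of_hasGoingUp l P
    rw [← hL]
    exact LTSeries.length_le_krullDim L
  · refine krullDim_le_of_strictMono (PrimeSpectrum.comap (algebraMap R S)) fun p q h => ?_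
    exact Ideal.IsIntegral.comap_lt_comap (R := R) (I := p.asIdeal) (J := q.asIdeal) h

/-- The dimension of an affine domain is its transcendence degree, by Noether normalization. -/
theorem exists_trdeg_eq_ringKrullDim (k D : Type*) [Field k] [CommRing D] [IsDomain D]
    [Algebra k D] [Algebra.FiniteType k D] :
    ∃ n : ℕ, Algebra.trdeg k D = n ∧ ringKrullDim D = n := by
  obtain ⟨n, f, hf, hfi⟩ := exists_integral_inj_algHom_of_fg k D
  refine ⟨n, ?_, ?_⟩
  · algebraize [f.toRingHom]
    have : FaithfulSMul (MvPolynomial (Fin n) k) D :=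
      (faithfulSMul_iff_algebraMap_injective _ _).mpr hf
    have h := lift_trdeg_add_eq k (MvPolynomial (Fin n) k) D
    have h0 : Algebra.trdeg (MvPolynomial (Fin n) k) D = 0 := trdeg_eq_zero
    rw [h0, MvPolynomial.trdeg_of_isDomain] at h
    simpa [eq_comm, Cardinal.lift_eq_nat_iff] using h
  · algebraize [f.toRingHom]
    have : FaithfulSMul (MvPolynomial (Fin n) k) D :=
      (faithfulSMul_iff_algebraMap_injective _ _).mpr hf
    rw [← ringKrullDim_eq_of_isIntegral (R := MvPolynomial (Fin n) k) (S := D),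
      MvPolynomial.ringKrullDim_of_isNoetherianRing]
    simp

/-- A dimension inequality for affine domains `C`, `D` with fraction fields `κ ⊆ L`: if `F` is a
finitely generated `κ`-algebra mapping to `L` with image containing `D`, then
`dim D ≤ dim C + dim F`. The image `E` of `F` has `Frac E = L`, so that
`dim D = trdeg_k L = trdeg_k κ + trdeg_κ L = dim C + dim E`. -/
theorem ringKrullDim_le_add_of_subset_range {k : Type*} {C D κ L F : Type u} [Field k]
    [CommRing C] [IsDomain C]
    [Algebra k C] [Algebra.FiniteType k C] [CommRing D] [IsDomain D] [Algebra k D]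
    [Algebra.FiniteType k D] [Field κ] [Field L] [Algebra k κ] [Algebra k L] [Algebra C κ]
    [IsScalarTower k C κ] [IsFractionRing C κ] [Algebra D L] [IsScalarTower k D L]
    [IsFractionRing D L] [Algebra κ L] [IsScalarTower k κ L] [CommRing F] [Algebra κ F]
    [Algebra.FiniteType κ F] (f : F →ₐ[κ] L) (hf : ∀ x : D, algebraMap D L x ∈ f.range) :
    ringKrullDim D ≤ ringKrullDim C + ringKrullDim F := by
  obtain ⟨a, ha, ha'⟩ := exists_trdeg_eq_ringKrullDim k C
  obtain ⟨b, hb, hb'⟩ := exists_trdeg_eq_ringKrullDim k D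
  have hE : Algebra.FiniteType κ f.range :=
    .of_surjective f.rangeRestrict f.rangeRestrict_surjective
  obtain ⟨c, hc, hc'⟩ := exists_trdeg_eq_ringKrullDim κ f.range
  have hcF : (c : WithBot ℕ∞) ≤ ringKrullDim F :=
    hc' ▸ ringKrullDim_le_of_surjective f.rangeRestrict.toRingHom f.rangeRestrict_surjective
  have : FaithfulSMul C κ := (faithfulSMul_iff_algebraMap_injective _ _).mpr
    (IsFractionRing.injective C κ)
  have : FaithfulSMul D L := (faithfulSMul_iff_algebraMap_injective _ _).mpr
    (IsFractionRing.injective D L)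
  have : Algebra.IsAlgebraic C κ := IsLocalization.isAlgebraic _ (nonZeroDivisors C)
  have : Algebra.IsAlgebraic D L := IsLocalization.isAlgebraic _ (nonZeroDivisors D)
  -- `L` is algebraic over `f.range` because it is already algebraic over the smaller ring `D`.
  have hL : Algebra.IsAlgebraic f.range L := by
    let φ : D →+* f.range := (algebraMap D L).codRestrict f.range hf
    algebraize [φ]
    have : IsScalarTower D f.range L := .of_algebraMap_eq fun _ => rfl
    refine Algebra.IsAlgebraic.extendScalars (R := D) (S := f.range) fun x y h => ?_
    exact IsFractionRing.injective D L (congrArg Subtype.val h)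
  have h1 := trdeg_add_eq k C (A := κ)
  have h2 := trdeg_add_eq k D (A := L)
  have h3 := trdeg_add_eq k κ (A := L)
  have h4 := trdeg_add_eq κ f.range (A := L)
  rw [trdeg_eq_zero (R := C), add_zero, ha] at h1
  rw [trdeg_eq_zero (R := D), add_zero, hb] at h2
  rw [trdeg_eq_zero (R := f.range), add_zero, hc] at h4
  rw [← h1, ← h2, ← h4] at h3
  have h : a + c = b := by exact_mod_cast h3
  rw [ha', hb', ← h]
  push_cast
  gcongr

/-! ### Rees algebras -/

open Polynomial in
/-- The Rees algebra of a nonzero ideal `J` of an affine domain `R` has dimension `dim R + 1`: for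
`0 ≠ x ∈ J` it lies between the polynomial rings `R[xt]` and `R[t]`, so its transcendence degree
over `R` is one. -/
theorem ringKrullDim_reesAlgebra {k : Type*} {R : Type*} [Field k] [CommRing R] [IsDomain R]
    [Algebra k R] [Algebra.FiniteType k R] {J : Ideal R} (hJ : J ≠ ⊥) :
    ringKrullDim (reesAlgebra J) = ringKrullDim R + 1 := by
  have : IsNoetherianRing R := Algebra.FiniteType.isNoetherianRing k R
  have : Algebra.FiniteType k (reesAlgebra J) := .trans (S := R) inferInstance inferInstance
  obtain ⟨a, ha, ha'⟩ := exists_trdeg_eq_ringKrullDim k R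
  obtain ⟨b, hb, hb'⟩ := exists_trdeg_eq_ringKrullDim k (reesAlgebra J)
  have h := trdeg_add_eq k R (A := reesAlgebra J)
  have h1 : Algebra.trdeg R (reesAlgebra J) = 1 := by
    apply le_antisymm
    · rw [← Polynomial.trdeg_of_isDomain (R := R)]
      exact trdeg_le_of_injective (reesAlgebra J).val Subtype.val_injective
    · obtain ⟨x, hx, hx0⟩ := Submodule.exists_mem_ne_zero_of_ne_bot hJ
      rw [← Polynomial.trdeg_of_isDomain (R := R)]
      let y : reesAlgebra J := ⟨monomial 1 x, reesAlgebra.monomial_mem.mpr (by simpa using hx)⟩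
      refine trdeg_le_of_injective (aeval y) ?_
      have hy : Function.Injective ((reesAlgebra J).val.comp (aeval y)) := by
        rw [injective_iff_map_eq_zero]
        intro p hp
        have : (reesAlgebra J).val.comp (aeval y) = aeval (C x * X) := by
          ext; simp [y, C_mul_X_eq_monomial]
        rw [this] at hp
        exact (comp_C_mul_X_eq_zero_iff (mem_nonZeroDivisors_of_ne_zero hx0)).mp hp
      exact Function.Injective.of_comp (f := (reesAlgebra J).val) hy
  rw [ha, hb, h1] at h
  rw [ha', hb']
  exact_mod_cast h.symm

open Polynomial in
/-- The map `R[Jt] → S[(JS)t]` applying a ring homomorphism `R → S` to the coefficients. -/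
noncomputable def reesAlgebraMap {R S : Type*} [CommRing R] [CommRing S] (f : R →+* S)
    (J : Ideal R) : reesAlgebra J →+* reesAlgebra (J.map f) :=
  ((mapRingHom f).comp (reesAlgebra J).val.toRingHom).codRestrict (reesAlgebra (J.map f)) (by
    intro x i
    have h := Ideal.mem_map_of_mem f (x.2 i)
    rw [Ideal.map_pow] at h
    simpa [coeff_map] using h)

theorem coe_reesAlgebraMap {R S : Type*} [CommRing R] [CommRing S] (f : R →+* S)
    (J : Ideal R) (x : reesAlgebra J) :
    (reesAlgebraMap f J x : Polynomial S) = (x : Polynomial R).map f :=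
  rfl

theorem reesAlgebraMap_algebraMap {R S : Type*} [CommRing R] [CommRing S] (f : R →+* S)
    (J : Ideal R) (x : R) :
    reesAlgebraMap f J (algebraMap R _ x) = algebraMap S _ (f x) :=
  Subtype.ext (Polynomial.map_C f)

/-- The decomposition of an element of the Rees algebra into its monomials. -/
theorem sum_monomial_reesAlgebra {R : Type*} [CommRing R] {J : Ideal R} (x : reesAlgebra J) :
    x = ∑ n ∈ (x : Polynomial R).support, ⟨Polynomial.monomial n ((x : Polynomial R).coeff n),
      reesAlgebra.monomial_mem.mpr (x.2 n)⟩ := by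
  apply Subtype.ext
  rw [AddSubmonoidClass.coe_finsetSum]
  exact (x : Polynomial R).as_sum_support

open Polynomial in
/-- Denominators in `M⁻¹R[(M⁻¹J)t]` can be cleared. -/
theorem reesAlgebra_exists_smul_mem_range {R R' : Type*} [CommRing R] [CommRing R'] [Algebra R R']
    (M : Submonoid R) [IsLocalization M R'] (J : Ideal R)
    (x : reesAlgebra (J.map (algebraMap R R'))) :
    ∃ s ∈ M, ∃ y, reesAlgebraMap (algebraMap R R') J y =
      algebraMap R' _ (algebraMap R R' s) * x := by
  rw [sum_monomial_reesAlgebra x]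
  refine Finset.sum_induction _ (fun z => ∃ s ∈ M, ∃ y, reesAlgebraMap (algebraMap R R') J y =
    algebraMap R' _ (algebraMap R R' s) * z) ?_ ?_ ?_
  · rintro a b ⟨s, hs, y, hy⟩ ⟨t, ht, z, hz⟩
    refine ⟨s * t, mul_mem hs ht, algebraMap R _ t * y + algebraMap R _ s * z, ?_⟩
    rw [map_add, map_mul, map_mul, hy, hz, reesAlgebraMap_algebraMap, reesAlgebraMap_algebraMap,
      map_mul, map_mul]
    ring
  · exact ⟨1, one_mem _, 0, by simp⟩
  · intro n _
    have hn := x.2 n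
    rw [← Ideal.map_pow, IsLocalization.mem_map_algebraMap_iff M R'] at hn
    obtain ⟨⟨⟨a, ha⟩, ⟨s, hs⟩⟩, h⟩ := hn
    refine ⟨s, hs, ⟨monomial n a, reesAlgebra.monomial_mem.mpr ha⟩, Subtype.ext ?_⟩
    rw [coe_reesAlgebraMap, map_monomial, ← h, mul_comm, ← C_mul_monomial]
    rfl

/-- The universal property of localization for Rees algebras: for a localization `R' = M⁻¹R`, the
algebra `R'[(JR')t]` is the localization of `R[Jt]` at `M`. -/
theorem reesAlgebra_exists_lift {R R' L : Type*} [CommRing R] [IsDomain R] [CommRing R']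
    [Algebra R R'] (M : Submonoid R) (hM : M ≤ nonZeroDivisors R) [IsLocalization M R']
    (J : Ideal R) [CommRing L] (ψ : reesAlgebra J →+* L)
    (hψ : ∀ s ∈ M, IsUnit (ψ (algebraMap R _ s))) :
    ∃ Ψ : reesAlgebra (J.map (algebraMap R R')) →+* L,
      Ψ.comp (reesAlgebraMap (algebraMap R R') J) = ψ := by
  let φ := reesAlgebraMap (algebraMap R R') J
  let := φ.toAlgebra
  have : IsLocalization (M.map (algebraMap R (reesAlgebra J)))
      (reesAlgebra (J.map (algebraMap R R'))) := by
    refine ⟨⟨?_, ?_, ?_⟩⟩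
    · rintro ⟨_, s, hs, rfl⟩
      change IsUnit (φ (algebraMap R _ s))
      rw [reesAlgebraMap_algebraMap]
      exact (IsLocalization.map_units R' ⟨s, hs⟩).map _
    · intro x
      obtain ⟨s, hs, y, hy⟩ := reesAlgebra_exists_smul_mem_range M J x
      refine ⟨⟨y, ⟨_, s, hs, rfl⟩⟩, ?_⟩
      change x * φ (algebraMap R _ s) = φ y
      rw [hy, reesAlgebraMap_algebraMap, mul_comm]
    · intro x y h
      refine ⟨1, ?_⟩
      have h' := congrArg Subtype.val h
      change (x : Polynomial R).map _ = (y : Polynomial R).map _ at h'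
      rw [Subtype.ext (Polynomial.map_injective _ (IsLocalization.injective R' hM) h')]
  refine ⟨IsLocalization.lift (M := M.map (algebraMap R (reesAlgebra J))) (g := ψ) ?_,
    IsLocalization.lift_comp _⟩
  rintro ⟨_, s, hs, rfl⟩
  exact hψ s hs

set_option maxHeartbeats 400000 in
/-- If the domain `D` is a quotient of the Rees algebra of an ideal `J` of an affine domain `R`, and
`P` is the contraction to `R` of its kernel, then `dim D ≤ dim R/P + ℓ(J_P)`: the localization of
`D` at the nonzero elements of `R/P` is a quotient of the fiber cone of `J_P`, an algebra over the
residue field of `P`. -/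
theorem ringKrullDim_le_add_analyticSpread {k R D : Type u} [Field k] [CommRing R] [IsDomain R]
    [Algebra k R] [Algebra.FiniteType k R] (J : Ideal R) [CommRing D] [IsDomain D]
    (φ : reesAlgebra J →+* D) (hφ : Function.Surjective φ) (P : Ideal R) [P.IsPrime]
    (hP : P = RingHom.ker (φ.comp (algebraMap R (reesAlgebra J)))) :
    ringKrullDim D ≤ ringKrullDim (R ⧸ P) +
      analyticSpread (J.map (algebraMap R (Localization.AtPrime P))) := by
  have : IsNoetherianRing R := Algebra.FiniteType.isNoetherianRing k R
  have : IsNoetherianRing (Localization.AtPrime P) :=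
    IsLocalization.isNoetherianRing P.primeCompl _ inferInstance
  let algkD : Algebra k D :=
    (φ.comp ((algebraMap R (reesAlgebra J)).comp (algebraMap k R))).toAlgebra
  obtain ⟨L, _, _, _, _, _⟩ : ∃ (L : Type u) (_ : Field L) (_ : Algebra D L) (_ : Algebra k L),
      IsFractionRing D L ∧ IsScalarTower k D L :=
    ⟨FractionRing D, inferInstance, inferInstance, inferInstance, inferInstance, inferInstance⟩
  let ι : D →+* L := algebraMap D L
  -- The map `R → D → L`, with kernel `P`; it inverts the complement of `P`.
  let ρ : R →+* L := ι.comp (φ.comp (algebraMap R (reesAlgebra J)))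
  have hρ : ∀ x, ρ x = 0 ↔ x ∈ P := fun x => by
    rw [hP, RingHom.mem_ker]
    exact map_eq_zero_iff ι (IsFractionRing.injective D L)
  have hρu : ∀ s ∈ P.primeCompl, IsUnit (ρ s) := fun s hs => by
    rw [isUnit_iff_ne_zero, Ne, hρ]; exact hs
  obtain ⟨Ψ, hΨ⟩ := reesAlgebra_exists_lift (R' := Localization.AtPrime P) P.primeCompl
    P.primeCompl_le_nonZeroDivisors J (ι.comp φ) hρu
  have hΨR : ∀ x : R, Ψ (algebraMap _ _ (algebraMap R (Localization.AtPrime P) x)) = ρ x :=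
    fun x => by
      rw [← reesAlgebraMap_algebraMap]
      exact congrArg (fun f => f (algebraMap R _ x)) hΨ
  have hm : ∀ x ∈ (IsLocalRing.maximalIdeal (Localization.AtPrime P)).map
      (algebraMap _ (reesAlgebra (J.map (algebraMap R (Localization.AtPrime P))))), Ψ x = 0 := by
    change _ ≤ RingHom.ker Ψ
    rw [Ideal.map_le_iff_le_comap, ← Localization.AtPrime.map_eq_maximalIdeal,
      Ideal.map_le_iff_le_comap]
    intro x hx
    exact (hΨR x).trans ((hρ x).mpr hx)
  -- The induced map from the fiber cone, and its linearity over the residue field of `P`.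
  let f₀ : FiberCone (J.map (algebraMap R (Localization.AtPrime P))) →+* L :=
    Ideal.Quotient.lift _ Ψ hm
  let algF : Algebra P.ResidueField
      (FiberCone (J.map (algebraMap R (Localization.AtPrime P)))) :=
    Ideal.Quotient.algebraQuotientMapQuotient (R := Localization.AtPrime P)
      (p := IsLocalRing.maximalIdeal _)
  have tow : IsScalarTower (Localization.AtPrime P) P.ResidueField
      (FiberCone (J.map (algebraMap R (Localization.AtPrime P)))) :=
    .of_algebraMap_eq fun _ => rfl
  have : Algebra.FiniteType (Localization.AtPrime P)
      (FiberCone (J.map (algebraMap R (Localization.AtPrime P)))) :=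
    .trans (S := reesAlgebra (J.map (algebraMap R (Localization.AtPrime P))))
      inferInstance inferInstance
  have : Algebra.FiniteType P.ResidueField
      (FiberCone (J.map (algebraMap R (Localization.AtPrime P)))) :=
    .of_restrictScalars_finiteType (Localization.AtPrime P) _ _
  let algL : Algebra P.ResidueField L :=
    (Ideal.ResidueField.lift P ρ (fun x hx => (hρ x).mpr hx) hρu).toAlgebra
  have hL : ∀ x : R, algebraMap P.ResidueField L (algebraMap R _ x) = ρ x := fun x =>
    Ideal.ResidueField.lift_algebraMap _ _ _ hρu x
  let f : FiberCone (J.map (algebraMap R (Localization.AtPrime P))) →ₐ[P.ResidueField] L :=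
    { f₀ with
      commutes' := by
        have : f₀.comp (algebraMap P.ResidueField _) = algebraMap P.ResidueField L := by
          apply Ideal.ResidueField.ringHom_ext
          ext x
          exact (hΨR x).trans (hL x).symm
        exact fun x => congrArg (fun g => g x) this }
  have : Algebra.FiniteType k D := by
    refine RingHom.FiniteType.comp (.of_surjective φ hφ) (.comp (g := algebraMap R _) ?_ ?_)
    · exact RingHom.finiteType_algebraMap.mpr inferInstance
    · exact RingHom.finiteType_algebraMap.mpr inferInstance
  have : IsScalarTower k P.ResidueField L := .of_algebraMap_eq fun x => by
    rw [IsScalarTower.algebraMap_apply k R P.ResidueField, hL,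
      IsScalarTower.algebraMap_apply k D L]
    rfl
  refine ringKrullDim_le_add_of_subset_range (k := k) (C := R ⧸ P) (D := D) (κ := P.ResidueField)
    (L := L) (F := FiberCone (J.map (algebraMap R (Localization.AtPrime P)))) f ?_
  intro x
  obtain ⟨y, rfl⟩ := hφ x
  exact ⟨Ideal.Quotient.mk _ (reesAlgebraMap _ J y), congrArg (fun g => g y) hΨ⟩

/-! ### Heights, coheights and minimal primes -/

theorem coheight_eq_ringKrullDim_quotient {S : Type*} [CommRing S] (p : PrimeSpectrum S) :
    (Order.coheight p : WithBot ℕ∞) = ringKrullDim (S ⧸ p.asIdeal) := by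
  rw [Order.coheight_eq_krullDim_Ici, ringKrullDim_quotient]
  rfl

theorem ringKrullDim_le_of_forall_minimalPrimes {S : Type*} [CommRing S] {N : WithBot ℕ∞}
    (h : ∀ Q ∈ minimalPrimes S, ringKrullDim (S ⧸ Q) ≤ N) : ringKrullDim S ≤ N := by
  rw [ringKrullDim, Order.krullDim_eq_iSup_coheight]
  refine iSup_le fun p => ?_
  obtain ⟨Q, hQ, hQp⟩ := Ideal.exists_minimalPrimes_le (J := p.asIdeal) bot_le
  rw [coheight_eq_ringKrullDim_quotient]
  exact (ringKrullDim_le_of_surjective (Ideal.Quotient.factor hQp)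
    (Ideal.Quotient.factor_surjective hQp)).trans (h Q hQ)

theorem height_add_ringKrullDim_quotient_le {S : Type*} [CommRing S] (p : Ideal S) [p.IsPrime] :
    (p.height : WithBot ℕ∞) + ringKrullDim (S ⧸ p) ≤ ringKrullDim S := by
  have : Nonempty (PrimeSpectrum S) := ⟨⟨p, inferInstance⟩⟩
  rw [PrimeSpectrum.height_eq_orderHeight ⟨p, inferInstance⟩,
    ← coheight_eq_ringKrullDim_quotient ⟨p, inferInstance⟩, ringKrullDim,
    Order.krullDim_eq_iSup_height_add_coheight_of_nonempty]
  exact_mod_cast le_iSup (fun a : PrimeSpectrum S => Order.height a + Order.coheight a)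
    ⟨p, inferInstance⟩

/-! ### The specialization map and the associated graded ring -/

section Specialization

variable {A R : Type*} [CommRing A] [CommRing R] [Algebra A R] (n : Ideal A) (J : Ideal R)

theorem includeRight_quotient_surjective (S : Type*) [CommRing S] [Algebra A S] :
    Function.Surjective (Algebra.TensorProduct.includeRight : S →ₐ[A] (A ⧸ n) ⊗[A] S) := by
  intro x
  induction x with
  | zero => exact ⟨0, map_zero _⟩
  | add x y hx hy =>
    obtain ⟨a, rfl⟩ := hx
    obtain ⟨b, rfl⟩ := hy
    exact ⟨a + b, map_add _ _ _⟩
  | tmul x y =>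
    obtain ⟨a, rfl⟩ := Ideal.Quotient.mk_surjective x
    refine ⟨a • y, ?_⟩
    rw [Algebra.TensorProduct.includeRight_apply, ← TensorProduct.smul_tmul]
    congr 1
    rw [Algebra.smul_def, mul_one]
    rfl

theorem includeRight_quotient_eq_zero {S : Type*} [CommRing S] [Algebra A S] {x : S}
    (hx : x ∈ n.map (algebraMap A S)) :
    (Algebra.TensorProduct.includeRight : S →ₐ[A] (A ⧸ n) ⊗[A] S) x = 0 := by
  have h : n.map (algebraMap A S) ≤ RingHom.ker
      (Algebra.TensorProduct.includeRight : S →ₐ[A] (A ⧸ n) ⊗[A] S) := by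
    rw [Ideal.map_le_iff_le_comap]
    intro a ha
    rw [Ideal.mem_comap, RingHom.mem_ker, AlgHom.commutes,
      Algebra.TensorProduct.algebraMap_apply, Ideal.Quotient.algebraMap_eq,
      Ideal.Quotient.eq_zero_iff_mem.mpr ha, TensorProduct.zero_tmul]
  exact h hx

theorem specializationMap_includeRight (x : reesAlgebra J) :
    specializationMap n J (Algebra.TensorProduct.includeRight x) = reesReduction n J x := by
  have := specializationMap_tmul n J 1 x
  rwa [one_smul] at this

theorem reesReduction_surjective : Function.Surjective (reesReduction n J) := by
  intro x
  rw [sum_monomial_reesAlgebra x]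
  refine Finset.sum_induction _ (fun z => ∃ y, reesReduction n J y = z) ?_ ⟨0, map_zero _⟩ ?_
  · rintro _ _ ⟨a, rfl⟩ ⟨b, rfl⟩
    exact ⟨a + b, map_add _ _ _⟩
  · intro i _
    have hi := x.2 i
    rw [← Ideal.map_pow, Ideal.mem_map_iff_of_surjective _ Ideal.Quotient.mk_surjective] at hi
    obtain ⟨c, hc, h⟩ := hi
    refine ⟨⟨Polynomial.monomial i c, reesAlgebra.monomial_mem.mpr hc⟩, Subtype.ext ?_⟩
    rw [coe_reesReduction, Polynomial.map_monomial, h]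

theorem specializationMap_surjective : Function.Surjective (specializationMap n J) := by
  intro x
  obtain ⟨y, rfl⟩ := reesReduction_surjective n J x
  exact ⟨_, specializationMap_includeRight n J y⟩

/-- If `b ∈ J ^ i` and `c ∈ 𝔫R`, then `bc tⁱ ∈ 𝔫R[Jt]`, whereas an element of `J ^ i ∩ 𝔫R` gives in
general no element of `𝔫R[Jt]`. -/
theorem monomial_mul_mem_map {i : ℕ} {b c : R} (hb : b ∈ J ^ i) (hc : c ∈ extendedIdeal R n) :
    (⟨Polynomial.monomial i (b * c),
        reesAlgebra.monomial_mem.mpr (Ideal.mul_mem_right _ _ hb)⟩ : reesAlgebra J) ∈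
      n.map (algebraMap A (reesAlgebra J)) := by
  induction hc using Submodule.span_induction generalizing b with
  | mem c h =>
    obtain ⟨a, ha, rfl⟩ := h
    have := Ideal.mul_mem_left (n.map (algebraMap A (reesAlgebra J)))
      ⟨Polynomial.monomial i b, reesAlgebra.monomial_mem.mpr hb⟩
      (Ideal.mem_map_of_mem (algebraMap A (reesAlgebra J)) ha)
    convert this
    exact (Polynomial.monomial_mul_C).symm
  | zero =>
    convert zero_mem (n.map (algebraMap A (reesAlgebra J)))
    simp
  | add x y _ _ hx hy =>
    convert add_mem (hx hb) (hy hb)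
    simp [mul_add]
  | smul r x _ hx =>
    convert hx (Ideal.mul_mem_right r _ hb) using 3
    rw [smul_eq_mul, mul_assoc]

/-- The structure map `R → R[Jt] ⊗_A A/𝔫`. -/
noncomputable def toReesTensor : R →+* ReesTensor n J :=
  ((Algebra.TensorProduct.includeRight : reesAlgebra J →ₐ[A] ReesTensor n J) : _ →+* _).comp
    (algebraMap R (reesAlgebra J))

variable {n J} in
theorem coeff_mem_of_reesReduction_eq_zero {y : reesAlgebra J} (hy : reesReduction n J y = 0)
    (i : ℕ) : (y : Polynomial R).coeff i ∈ extendedIdeal R n := by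
  have := congrArg (fun z => Polynomial.coeff z.1 i) hy
  simp only [coe_reesReduction, Polynomial.coeff_map] at this
  exact Ideal.Quotient.eq_zero_iff_mem.mp this

/-- The kernel of the specialization map is `J`-power torsion. If `∑ cᵢ tⁱ`, of degree `N`,
represents an element of the kernel, then `cᵢ ∈ 𝔫R` and `a ^ N ∈ J ^ i` for all `i ≤ N`, so
`a ^ N * ∑ cᵢ tⁱ` lies in `𝔫R[Jt]`. -/
theorem toReesTensor_pow_mul_eq_zero {a : R} (ha : a ∈ J) {x : ReesTensor n J}
    (hx : x ∈ specializationKer n J) : ∃ N, toReesTensor n J a ^ N * x = 0 := by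
  obtain ⟨y, rfl⟩ := includeRight_quotient_surjective n _ x
  rw [RingHom.mem_ker, specializationMap_includeRight] at hx
  refine ⟨(y : Polynomial R).natDegree, ?_⟩
  rw [toReesTensor, RingHom.comp_apply, ← map_pow, ← map_pow]
  refine (map_mul _ _ _).symm.trans (includeRight_quotient_eq_zero n ?_)
  nth_rw 2 [sum_monomial_reesAlgebra y]
  rw [Finset.mul_sum]
  refine Ideal.sum_mem _ fun i hi => ?_
  have hb : a ^ (y : Polynomial R).natDegree ∈ J ^ i :=
    Ideal.pow_le_pow_right (Polynomial.le_natDegree_of_mem_supp i hi) (Ideal.pow_mem_pow ha _)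
  convert monomial_mul_mem_map n J hb (coeff_mem_of_reesReduction_eq_zero hx i)
  exact Polynomial.C_mul_monomial

theorem extensionToReesTensor_eq_map :
    extensionToReesTensor n J = J.map (toReesTensor n J) := by
  rw [extensionToReesTensor]
  exact Ideal.map_map _ _

/-- Away from `V(J)` the kernel of the specialization map vanishes. -/
theorem specializationKer_le_of_not_le {Q : Ideal (ReesTensor n J)} [Q.IsPrime]
    (hQ : ¬ extensionToReesTensor n J ≤ Q) : specializationKer n J ≤ Q := by
  rw [extensionToReesTensor_eq_map, Ideal.map_le_iff_le_comap, SetLike.not_le_iff_exists] at hQ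
  obtain ⟨a, ha, haQ⟩ := hQ
  intro x hx
  obtain ⟨N, hN⟩ := toReesTensor_pow_mul_eq_zero n J ha hx
  have : toReesTensor n J a ^ N * x ∈ Q := hN ▸ zero_mem _
  exact (Ideal.IsPrime.mem_or_mem ‹_› this).resolve_left
    fun h => haQ (Ideal.IsPrime.mem_of_pow_mem (I := Q) ‹_› _ h)

theorem specializationMap_toReesTensor (a : R) :
    specializationMap n J (toReesTensor n J a) =
      algebraMap _ _ (Ideal.Quotient.mk (extendedIdeal R n) a) :=
  (specializationMap_includeRight n J _).trans (Subtype.ext (Polynomial.map_C _))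

theorem exists_toReesTensor_notMem (hI : specializedIdeal n J ≠ ⊥) :
    ∃ a ∈ J, toReesTensor n J a ∉ specializationKer n J := by
  by_contra! h
  apply hI
  rw [specializedIdeal, Ideal.map_eq_bot_iff_le_ker, Ideal.mk_ker]
  intro a ha
  have := h a ha
  rw [RingHom.mem_ker, specializationMap_toReesTensor] at this
  exact Ideal.Quotient.eq_zero_iff_mem.mp
    (Polynomial.C_eq_zero.mp (congrArg Subtype.val this))

theorem specializationKer_not_ge (hI : specializedIdeal n J ≠ ⊥) :
    ¬ extensionToReesTensor n J ≤ specializationKer n J := by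
  obtain ⟨a, ha, h⟩ := exists_toReesTensor_notMem n J hI
  rw [extensionToReesTensor_eq_map]
  exact fun h' => h (h' (Ideal.mem_map_of_mem _ ha))

instance specializationKer_isPrime [(extendedIdeal R n).IsPrime] :
    (specializationKer n J).IsPrime :=
  RingHom.ker_isPrime _

theorem specializationKer_mem_minimalPrimes [(extendedIdeal R n).IsPrime]
    (hI : specializedIdeal n J ≠ ⊥) : specializationKer n J ∈ minimalPrimes (ReesTensor n J) := by
  refine ⟨⟨inferInstance, bot_le⟩, fun Q hQ hle => ?_⟩
  have := hQ.1
  exact specializationKer_le_of_not_le n J fun h =>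
    specializationKer_not_ge n J hI (h.trans hle)

theorem reesTensorToAssocGraded_surjective :
    Function.Surjective (reesTensorToAssocGraded n J) :=
  Algebra.TensorProduct.map_surjective _ _ Function.surjective_id Ideal.Quotient.mk_surjective

theorem ker_reesTensorToAssocGraded :
    RingHom.ker (reesTensorToAssocGraded n J) = extensionToReesTensor n J := by
  refine (Algebra.TensorProduct.lTensor_ker (A := A ⧸ n) (reesToAssocGraded A J)
    Ideal.Quotient.mk_surjective).trans ?_
  congr 1
  exact Ideal.mk_ker

/-- The isomorphism of `R[Jt] ⊗_A A/𝔫` modulo the extension of `J` with `gr_J(R) ⊗_A A/𝔫`. -/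
noncomputable def quotientExtensionEquiv :
    (ReesTensor n J ⧸ extensionToReesTensor n J) ≃+* AssocGradedTensor n J :=
  (Ideal.quotEquivOfEq (ker_reesTensorToAssocGraded n J).symm).trans
    (RingHom.quotientKerEquivOfSurjective (f := (reesTensorToAssocGraded n J).toRingHom)
      (reesTensorToAssocGraded_surjective n J))

theorem quotientExtensionEquiv_mk (x : ReesTensor n J) :
    quotientExtensionEquiv n J (Ideal.Quotient.mk _ x) = reesTensorToAssocGraded n J x :=
  rfl

variable {n J} in
theorem extensionToReesTensor_le_of_mem_minimalPrimes [(extendedIdeal R n).IsPrime]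
    {Q : Ideal (ReesTensor n J)} (hQ : Q ∈ minimalPrimes (ReesTensor n J))
    (hne : Q ≠ specializationKer n J) : extensionToReesTensor n J ≤ Q := by
  by_contra h
  have := hQ.1.1
  have hle := specializationKer_le_of_not_le n J h
  exact hne (le_antisymm (hQ.2 ⟨inferInstance, bot_le⟩ hle) hle)

theorem exists_minimalPrimes_comap_eq {S S' : Type*} [CommRing S] [CommRing S'] {f : S →+* S'}
    (hf : Function.Surjective f) {Q : Ideal S} (hQ : Q ∈ minimalPrimes S)
    (hle : RingHom.ker f ≤ Q) : ∃ q ∈ minimalPrimes S', q.comap f = Q := by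
  have := hQ.1.1
  have hcomap : (Q.map f).comap f = Q := by
    rw [Ideal.comap_map_of_surjective' f hf, sup_eq_left.mpr hle]
  refine ⟨Q.map f, ⟨⟨Ideal.map_isPrime_of_surjective hf hle, bot_le⟩, fun p hp hpQ => ?_⟩, hcomap⟩
  have := hp.1
  rw [Ideal.map_le_iff_le_comap]
  exact hQ.2 ⟨inferInstance, bot_le⟩ ((Ideal.comap_mono hpQ).trans hcomap.le)

theorem ringKrullDim_quotient_extension :
    ringKrullDim (ReesTensor n J ⧸ extensionToReesTensor n J) =
      ringKrullDim (AssocGradedTensor n J) :=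
  ringKrullDim_eq_of_ringEquiv (quotientExtensionEquiv n J)

variable {n J} in
theorem ringKrullDim_quotient_le_assocGraded {Q : Ideal (ReesTensor n J)}
    (hQ : extensionToReesTensor n J ≤ Q) :
    ringKrullDim (ReesTensor n J ⧸ Q) ≤ ringKrullDim (AssocGradedTensor n J) := by
  rw [← ringKrullDim_quotient_extension]
  exact ringKrullDim_le_of_surjective (Ideal.Quotient.factor hQ)
    (Ideal.Quotient.factor_surjective hQ)

/-- The minimal primes of `R[Jt] ⊗_A A/𝔫` are among the kernel of the specialization map, whose
quotient is the Rees algebra of the specialized ideal, and primes containing `J`, whose quotients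
are quotients of `gr_J(R) ⊗_A A/𝔫`. -/
theorem ringKrullDim_reesTensor [(extendedIdeal R n).IsPrime] :
    ringKrullDim (ReesTensor n J) = max (ringKrullDim (reesAlgebra (specializedIdeal n J)))
      (ringKrullDim (AssocGradedTensor n J)) := by
  apply le_antisymm
  · refine ringKrullDim_le_of_forall_minimalPrimes fun Q hQ => ?_
    by_cases h : Q = specializationKer n J
    · subst h
      exact le_max_of_le_left (ringKrullDim_eq_of_ringEquiv
        (RingHom.quotientKerEquivOfSurjective (f := (specializationMap n J).toRingHom)
          (specializationMap_surjective n J))).le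
    · exact le_max_of_le_right (ringKrullDim_quotient_le_assocGraded
        (extensionToReesTensor_le_of_mem_minimalPrimes hQ h))
  · exact max_le
      (ringKrullDim_le_of_surjective (specializationMap n J).toRingHom
        (specializationMap_surjective n J))
      (ringKrullDim_le_of_surjective (reesTensorToAssocGraded n J).toRingHom
        (reesTensorToAssocGraded_surjective n J))

/-- The kernel of the specialization map, being `J`-power torsion, is supported in `V(J)`, which is
the spectrum of `gr_J(R) ⊗_A A/𝔫`. -/
theorem supportDim_specializationKer_le :
    Module.supportDim (ReesTensor n J) (specializationKer n J) ≤
      ringKrullDim (AssocGradedTensor n J) := by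
  have h : Module.support (ReesTensor n J) (specializationKer n J) ⊆
      PrimeSpectrum.zeroLocus (extensionToReesTensor n J : Set (ReesTensor n J)) := by
    intro p hp
    rw [Module.mem_support_iff'] at hp
    obtain ⟨x, hx⟩ := hp
    by_contra hp
    rw [PrimeSpectrum.mem_zeroLocus, SetLike.coe_subset_coe, extensionToReesTensor_eq_map,
      Ideal.map_le_iff_le_comap, SetLike.not_le_iff_exists] at hp
    obtain ⟨a, ha, haQ⟩ := hp
    obtain ⟨N, hN⟩ := toReesTensor_pow_mul_eq_zero n J ha x.2
    exact hx (toReesTensor n J a ^ N)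
      (fun h => haQ (Ideal.IsPrime.mem_of_pow_mem p.2 _ h)) (Subtype.ext hN)
  rw [← ringKrullDim_quotient_extension, ringKrullDim_quotient]
  exact Order.krullDim_le_of_strictMono (Set.inclusion h) fun _ _ => id

end Specialization

/-! ### The dimension of the associated graded ring -/

/-- A bound on the analytic spreads `ℓ(J_P)` for `P ⊇ (J, 𝔫)` bounds the dimension of
`gr_J(R) ⊗_A A/𝔫`: its quotient by a minimal prime lying over `P ⊂ R` has dimension at most
`dim R/P + ℓ(J_P) ≤ dim R/P + ht (P/𝔫R) + l`. -/
theorem ringKrullDim_assocGradedTensor_le {k A R : Type u} [Field k] [CommRing A] [CommRing R]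
    [IsDomain R] [Algebra A R] [Algebra k R] [Algebra.FiniteType k R] (n : Ideal A) (J : Ideal R)
    (l : WithBot ℕ∞)
    (h : ∀ (P : Ideal R) [P.IsPrime], J ≤ P → extendedIdeal R n ≤ P →
      analyticSpread (J.map (algebraMap R (Localization.AtPrime P))) ≤
        ((P.map (Ideal.Quotient.mk (extendedIdeal R n))).height : WithBot ℕ∞) + l) :
    ringKrullDim (AssocGradedTensor n J) ≤ ringKrullDim (R ⧸ extendedIdeal R n) + l := by
  refine ringKrullDim_le_of_forall_minimalPrimes fun q hq => ?_
  have := hq.1.1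
  let φ : reesAlgebra J →+* AssocGradedTensor n J ⧸ q :=
    ((Ideal.Quotient.mk q).comp (reesTensorToAssocGraded n J).toRingHom).comp
      (Algebra.TensorProduct.includeRight : reesAlgebra J →ₐ[A] ReesTensor n J).toRingHom
  have hφ : Function.Surjective φ :=
    (Ideal.Quotient.mk_surjective.comp (reesTensorToAssocGraded_surjective n J)).comp
      (includeRight_quotient_surjective n _)
  set P := RingHom.ker (φ.comp (algebraMap R (reesAlgebra J))) with hP
  have : P.IsPrime := RingHom.ker_isPrime _
  have hJ : J ≤ P := fun a ha => by
    have h0 : reesTensorToAssocGraded n J (toReesTensor n J a) = 0 := by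
      rw [← RingHom.mem_ker, ker_reesTensorToAssocGraded, extensionToReesTensor_eq_map]
      exact Ideal.mem_map_of_mem _ ha
    exact (congrArg (Ideal.Quotient.mk q) h0).trans (map_zero _)
  have hn : extendedIdeal R n ≤ P := by
    rw [extendedIdeal, Ideal.map_le_iff_le_comap]
    intro a ha
    have h0 := includeRight_quotient_eq_zero n
      (Ideal.mem_map_of_mem (algebraMap A (reesAlgebra J)) ha)
    exact (congrArg (fun x => Ideal.Quotient.mk q (reesTensorToAssocGraded n J x)) h0).trans
      (by rw [map_zero, map_zero])
  have : (P.map (Ideal.Quotient.mk (extendedIdeal R n))).IsPrime :=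
    Ideal.map_isPrime_of_surjective Ideal.Quotient.mk_surjective (by rwa [Ideal.mk_ker])
  calc ringKrullDim (AssocGradedTensor n J ⧸ q)
      ≤ ringKrullDim (R ⧸ P) + analyticSpread (J.map (algebraMap R (Localization.AtPrime P))) :=
        ringKrullDim_le_add_analyticSpread (k := k) J φ hφ P hP
    _ ≤ ringKrullDim (R ⧸ P) +
          (((P.map (Ideal.Quotient.mk (extendedIdeal R n))).height : WithBot ℕ∞) + l) := by
        gcongr
        exact h P hJ hn
    _ = ((P.map (Ideal.Quotient.mk (extendedIdeal R n))).height : WithBot ℕ∞) +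
          ringKrullDim ((R ⧸ extendedIdeal R n) ⧸ P.map (Ideal.Quotient.mk _)) + l := by
        rw [ringKrullDim_eq_of_ringEquiv (DoubleQuot.quotQuotEquivQuotOfLE hn), ← add_assoc,
          add_comm (ringKrullDim _)]
    _ ≤ _ := by
        gcongr
        exact height_add_ringKrullDim_quotient_le _

/-! ### Comparison of homogeneous localizations -/

section HomogeneousLocalization

variable {ι σ T M τ : Type*} [CommRing T] [CommRing M] [Algebra T M]
  [SetLike σ T] [AddSubgroupClass σ T] [AddCommMonoid ι] [DecidableEq ι]
  (𝒯 : ι → σ) [GradedRing 𝒯] [SetLike τ M] [AddSubgroupClass τ M] (ℳ : ι → τ)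
  [SetLike.GradedSMul 𝒯 ℳ] (P : Ideal T) [P.IsPrime]

theorem homogeneousLocalization_mk_smul (i : ι) (a b : 𝒯 i) (hb : (b : T) ∈ P.primeCompl) :
    (HomogeneousLocalization.mk ⟨i, a, b, hb⟩ : HomogeneousLocalization.AtPrime 𝒯 P) •
        (LocalizedModule.mk 1 1 : LocalizedModule P.primeCompl M) =
      LocalizedModule.mk (algebraMap T M (a : T)) ⟨(b : T), hb⟩ := by
  rw [homogeneousLocalization_smul_def, HomogeneousLocalization.val_mk,
    LocalizedModule.mk_smul_mk, mul_one, Algebra.smul_def, mul_one]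

/-- A graded surjection `T → M` of rings whose kernel is torsion with respect to the complement of
`P` induces an isomorphism `T_(P) ≃ M_(P)`. The isomorphism is `c ↦ c • (1 / 1)`. -/
theorem exists_homogeneousLocalization_equiv
    (hone : (1 : M) ∈ ℳ 0) (hlift : ∀ i, ∀ x ∈ ℳ i, ∃ t ∈ 𝒯 i, algebraMap T M t = x)
    (htors : ∀ x, algebraMap T M x = 0 → ∃ u ∈ P.primeCompl, u * x = 0) :
    ∃ e : HomogeneousLocalization.AtPrime 𝒯 P ≃ₗ[HomogeneousLocalization.AtPrime 𝒯 P]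
        moduleHomogeneousLocalization 𝒯 ℳ P,
      ∀ (i : ι) (a b : 𝒯 i) (hb : (b : T) ∈ P.primeCompl),
        (e (HomogeneousLocalization.mk ⟨i, a, b, hb⟩)).val =
          LocalizedModule.mk (algebraMap T M (a : T)) ⟨(b : T), hb⟩ := by
  let x₀ : moduleHomogeneousLocalization 𝒯 ℳ P :=
    ⟨LocalizedModule.mk 1 1, 0, 1, 1, hone, SetLike.one_mem_graded 𝒯, rfl⟩
  let φ := LinearMap.toSpanSingleton (HomogeneousLocalization.AtPrime 𝒯 P) _ x₀
  have hφ (i : ι) (a b : 𝒯 i) (hb : (b : T) ∈ P.primeCompl) :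
      (φ (HomogeneousLocalization.mk ⟨i, a, b, hb⟩)).val =
        LocalizedModule.mk (algebraMap T M (a : T)) ⟨(b : T), hb⟩ :=
    homogeneousLocalization_mk_smul 𝒯 P i a b hb
  refine ⟨LinearEquiv.ofBijective φ ⟨?_, ?_⟩, hφ⟩
  · rw [injective_iff_map_eq_zero]
    intro c hc
    obtain ⟨⟨i, a, b, hb⟩, rfl⟩ := HomogeneousLocalization.mk_surjective c
    have h := congrArg Subtype.val hc
    rw [hφ, ZeroMemClass.coe_zero, ← LocalizedModule.zero_mk 1, LocalizedModule.mk_eq] at h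
    obtain ⟨u, hu⟩ := h
    rw [smul_zero, smul_zero, one_smul, Submonoid.smul_def, Algebra.smul_def, ← map_mul] at hu
    obtain ⟨v, hv, hv0⟩ := htors _ hu
    apply HomogeneousLocalization.val_injective
    rw [HomogeneousLocalization.val_mk, HomogeneousLocalization.val_zero,
      Localization.mk_eq_mk', IsLocalization.mk'_eq_zero_iff]
    exact ⟨⟨v, hv⟩ * u, by rw [Submonoid.coe_mul, mul_assoc]; exact hv0⟩
  · rintro ⟨_, i, x, ⟨b, hbP⟩, hx, hb, rfl⟩
    obtain ⟨t, ht, rfl⟩ := hlift i x hx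
    exact ⟨HomogeneousLocalization.mk ⟨i, ⟨t, ht⟩, ⟨b, hb⟩, hbP⟩, Subtype.ext (hφ i _ _ _)⟩

end HomogeneousLocalization

/-! ### The polynomial setting -/

section Setup

variable {k : Type*} [Field k] {m r s d : ℕ}

theorem pointIdeal_eq_ker (α : Fin m → k) :
    pointIdeal α = RingHom.ker (MvPolynomial.aeval α : CoeffRing k m →ₐ[k] k) := by
  apply le_antisymm
  · rw [pointIdeal, Ideal.span_le]
    rintro _ ⟨i, rfl⟩
    simp [RingHom.mem_ker]
  · intro p hp
    -- Modulo `𝔫` each `z_i` equals `α_i`, so every `p ∈ A` is congruent to its value at `α`.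
    have h : Ideal.Quotient.mkₐ k (pointIdeal α) =
        (Algebra.ofId k _).comp (MvPolynomial.aeval α) := by
      ext i
      have : (MvPolynomial.X i - MvPolynomial.C (α i) : CoeffRing k m) ∈ pointIdeal α :=
        Ideal.subset_span ⟨i, rfl⟩
      simpa using! (Ideal.Quotient.eq (I := pointIdeal α)).mpr this
    have h' := congrArg (fun f => f p) h
    rw [RingHom.mem_ker] at hp
    simp only [AlgHom.comp_apply, hp, map_zero] at h'
    exact Ideal.Quotient.eq_zero_iff_mem.mp h'

instance pointIdeal_isMaximal (α : Fin m → k) : (pointIdeal α).IsMaximal := by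
  rw [pointIdeal_eq_ker]
  exact RingHom.ker_isMaximal_of_surjective _ fun x => ⟨MvPolynomial.C x, by simp⟩

/-- The isomorphism `(A/𝔫)[x_0, …, x_r] ≃ R/𝔫R`. -/
noncomputable def specializedSourceEquiv (n : Ideal (CoeffRing k m)) (r : ℕ) :
    MvPolynomial (Fin (r + 1)) (CoeffRing k m ⧸ n) ≃+*
      SourceRing k m r ⧸ extendedIdeal (SourceRing k m r) n :=
  (MvPolynomial.quotientEquivQuotientMvPolynomial n).toRingEquiv

instance extendedIdeal_isPrime (n : Ideal (CoeffRing k m)) [n.IsPrime] :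
    (extendedIdeal (SourceRing k m r) n).IsPrime := by
  rw [← Ideal.Quotient.isDomain_iff_prime]
  exact (specializedSourceEquiv n r).symm.toMulEquiv.isDomain _

theorem ringKrullDim_specializedSource (n : Ideal (CoeffRing k m)) [n.IsMaximal] :
    ringKrullDim (SourceRing k m r ⧸ extendedIdeal (SourceRing k m r) n) =
      (r : WithBot ℕ∞) + 1 := by
  let := Ideal.Quotient.field n
  rw [← ringKrullDim_eq_of_ringEquiv (specializedSourceEquiv n r),
    MvPolynomial.ringKrullDim_of_isNoetherianRing, ringKrullDim_eq_zero_of_field]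
  simp

theorem ringKrullDim_specializedRees (n : Ideal (CoeffRing k m)) [n.IsMaximal]
    {J : Ideal (SourceRing k m r)} (hI : specializedIdeal n J ≠ ⊥) :
    ringKrullDim (reesAlgebra (specializedIdeal n J)) = (r : WithBot ℕ∞) + 2 := by
  rw [ringKrullDim_reesAlgebra (k := k) hI, ringKrullDim_specializedSource, add_assoc]
  rfl

/-! ### Bihomogeneity of the kernel -/

variable (n : Ideal (CoeffRing k m))
  (g : Fin (s + 1) → Forms k m r d)

theorem mem_extendedIdeal_iff {f : SourceRing k m r} :
    f ∈ extendedIdeal (SourceRing k m r) n ↔ ∀ i, MvPolynomial.coeff i f ∈ n :=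
  MvPolynomial.mem_map_C_iff

theorem extendedIdeal_isHomogeneous :
    (extendedIdeal (SourceRing k m r) n).IsHomogeneous (sourceGrading k m r) := by
  refine Ideal.homogeneous_span _ _ ?_
  rintro _ ⟨a, -, rfl⟩
  exact ⟨0, MvPolynomial.isHomogeneous_C _ a⟩

theorem formsIdeal_pow_eq_span (i : ℕ) :
    ∃ S' : Set (SourceRing k m r), S' ⊆ sourceGrading k m r (i * d) ∧
      formsIdeal g ^ i = Ideal.span S' :=
  pow_subset_graded (sourceGrading k m r) (by rintro _ ⟨j, rfl⟩; exact (g j).2) i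

theorem formsIdeal_pow_isHomogeneous (i : ℕ) :
    (formsIdeal g ^ i).IsHomogeneous (sourceGrading k m r) := by
  obtain ⟨S', hS', hpow⟩ := formsIdeal_pow_eq_span g i
  rw [hpow]
  exact Ideal.homogeneous_span _ _ fun x hx => ⟨_, hS' hx⟩

theorem includeRight_mem_reesTensorBigrading {i : ℕ × ℕ} {y : reesAlgebra (formsIdeal g)}
    (hy : y ∈ reesBigrading (sourceGrading k m r) (formsIdeal g) d i) :
    (Algebra.TensorProduct.includeRight y : ReesTensor n (formsIdeal g)) ∈
      reesTensorBigrading n g i :=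
  Submodule.tmul_mem_baseChange_of_mem _ hy

/-- The specialization map is surjective in each bidegree: a preimage in `𝓘 ^ e` of a form in the
`e`-th power of the specialized ideal may be replaced by its homogeneous component, because
`𝓘 ^ e` and `𝔫R` are homogeneous. -/
theorem exists_mem_reesTensorBigrading {i : ℕ × ℕ}
    {x : reesAlgebra (specializedIdeal n (formsIdeal g))}
    (hx : x ∈ specializedReesBigrading n g i) :
    ∃ t ∈ reesTensorBigrading n g i, specializationMap n (formsIdeal g) t = x := by
  obtain ⟨_, ⟨F', hF', rfl⟩, hxf⟩ := hx
  have hi := x.2 i.2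
  rw [hxf, Polynomial.coeff_monomial, if_pos rfl, ← Ideal.map_pow,
    Ideal.mem_map_iff_of_surjective _ Ideal.Quotient.mk_surjective] at hi
  obtain ⟨F, hF, h⟩ := hi
  have hcomp := formsIdeal_pow_isHomogeneous g i.2 (i.1 + i.2 * d) hF
  have hsub := extendedIdeal_isHomogeneous n (i.1 + i.2 * d) ((Ideal.Quotient.eq).mp h)
  rw [← GradedAlgebra.proj_apply, map_sub, GradedAlgebra.proj_apply, GradedAlgebra.proj_apply,
    DirectSum.decompose_of_mem_same _ hF'] at hsub
  refine ⟨Algebra.TensorProduct.includeRight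
    ⟨Polynomial.monomial i.2 _, reesAlgebra.monomial_mem.mpr hcomp⟩,
    includeRight_mem_reesTensorBigrading n g ⟨_, SetLike.coe_mem _, rfl⟩, Subtype.ext ?_⟩
  rw [specializationMap_includeRight, coe_reesReduction, hxf, Polynomial.map_monomial,
    Ideal.Quotient.eq.mpr hsub]
  rfl

/-- A monomial `c tⁱ` with `c ∈ 𝓘 ^ i ∩ 𝔫R` is a sum of bihomogeneous elements of the kernel, namely
of the monomials on the homogeneous components of `c`. -/
theorem includeRight_monomial_mem_span {i : ℕ} {c : SourceRing k m r}
    (hcJ : c ∈ formsIdeal g ^ i) (hcn : c ∈ extendedIdeal (SourceRing k m r) n) :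
    (Algebra.TensorProduct.includeRight (⟨Polynomial.monomial i c,
        reesAlgebra.monomial_mem.mpr hcJ⟩ : reesAlgebra (formsIdeal g)) :
      ReesTensor n (formsIdeal g)) ∈ Ideal.span {z | z ∈ specializationKer n (formsIdeal g) ∧
        SetLike.IsHomogeneousElem (reesTensorBigrading n g) z} := by
  classical
  have hmem : ∀ e, Polynomial.monomial i
      ((DirectSum.decompose (sourceGrading k m r) c e : sourceGrading k m r e) :
        SourceRing k m r) ∈ reesAlgebra (formsIdeal g) := fun e =>
    reesAlgebra.monomial_mem.mpr (formsIdeal_pow_isHomogeneous g i e hcJ)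
  have hsum : (⟨Polynomial.monomial i c, reesAlgebra.monomial_mem.mpr hcJ⟩ :
      reesAlgebra (formsIdeal g)) =
      ∑ e ∈ (DirectSum.decompose (sourceGrading k m r) c).support, ⟨_, hmem e⟩ := by
    apply Subtype.ext
    rw [AddSubmonoidClass.coe_finsetSum]
    simp only
    rw [← map_sum, DirectSum.sum_support_decompose (sourceGrading k m r) c]
  rw [hsum, map_sum]
  refine Ideal.sum_mem _ fun e _ => ?_
  -- Components of degree less than `i * d` vanish, as `𝓘 ^ i` is generated in degree `i * d`; the
  -- others have a bidegree with nonnegative first entry.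
  by_cases he : e < i * d
  · obtain ⟨S', hS', hpow⟩ := formsIdeal_pow_eq_span g i
    have hz := decompose_eq_zero_of_mem_span (sourceGrading k m r) hS' (hpow ▸ hcJ) he
    have h0 : (⟨_, hmem e⟩ : reesAlgebra (formsIdeal g)) = 0 :=
      Subtype.ext ((congrArg (Polynomial.monomial i) hz).trans (map_zero _))
    rw [h0, map_zero]
    exact zero_mem _
  · refine Ideal.subset_span ⟨?_, (e - i * d, i),
      includeRight_mem_reesTensorBigrading n g ⟨_, ?_, rfl⟩⟩
    · rw [RingHom.mem_ker, specializationMap_includeRight]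
      apply Subtype.ext
      rw [coe_reesReduction, Polynomial.map_monomial,
        Ideal.Quotient.eq_zero_iff_mem.mpr (extendedIdeal_isHomogeneous n e hcn),
        Polynomial.monomial_zero_right]
      rfl
    · simp only
      rw [Nat.sub_add_cancel (not_lt.mp he)]
      exact SetLike.coe_mem _

theorem specializationKer_isHomogeneous :
    (specializationKer n (formsIdeal g)).IsHomogeneous (reesTensorBigrading n g) := by
  have h : specializationKer n (formsIdeal g) =
      Ideal.span {z | z ∈ specializationKer n (formsIdeal g) ∧
        SetLike.IsHomogeneousElem (reesTensorBigrading n g) z} := by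
    refine le_antisymm (fun x hx => ?_) (Ideal.span_le.mpr fun z hz => hz.1)
    obtain ⟨y, rfl⟩ := includeRight_quotient_surjective n _ x
    rw [RingHom.mem_ker, specializationMap_includeRight] at hx
    rw [sum_monomial_reesAlgebra y, map_sum]
    exact Ideal.sum_mem _ fun i _ => includeRight_monomial_mem_span n g (y.2 i)
      (coeff_mem_of_reesReduction_eq_zero hx i)
  rw [h]
  exact Ideal.homogeneous_span _ _ fun z hz => hz.2

/-- The product of `x₀`, of bidegree `(1, 0)`, with `gⱼ t`, of bidegree `(0, 1)`, lies in the
irrelevant ideal, and not in the kernel if `gⱼ ∉ 𝔫R`. -/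
theorem specializationKer_isBiProjPoint [n.IsPrime]
    (hI : specializedIdeal n (formsIdeal g) ≠ ⊥) :
    IsBiProjPoint (reesTensorBigrading n g) (specializationKer n (formsIdeal g)) := by
  refine ⟨inferInstance, specializationKer_isHomogeneous n g, fun hle => ?_⟩
  obtain ⟨j, hj⟩ : ∃ j, (g j : SourceRing k m r) ∉ extendedIdeal (SourceRing k m r) n := by
    by_contra! h
    apply hI
    rw [specializedIdeal, Ideal.map_eq_bot_iff_le_ker, Ideal.mk_ker, formsIdeal, Ideal.span_le]
    rintro _ ⟨j, rfl⟩
    exact h j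
  let x : reesAlgebra (formsIdeal g) := algebraMap (SourceRing k m r) _ (MvPolynomial.X 0)
  let y : reesAlgebra (formsIdeal g) := ⟨Polynomial.monomial 1 (g j : SourceRing k m r),
    reesAlgebra.monomial_mem.mpr (by
      rw [pow_one]; exact Ideal.subset_span ⟨j, rfl⟩)⟩
  have hx : x ∈ reesBigrading (sourceGrading k m r) (formsIdeal g) d (1, 0) :=
    ⟨MvPolynomial.X 0,
      by simpa using! MvPolynomial.isHomogeneous_X (CoeffRing k m) (0 : Fin (r + 1)), rfl⟩
  have hy : y ∈ reesBigrading (sourceGrading k m r) (formsIdeal g) d (0, 1) :=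
    ⟨g j, by simp, rfl⟩
  have hxy : (Algebra.TensorProduct.includeRight x : ReesTensor n (formsIdeal g)) *
      Algebra.TensorProduct.includeRight y ∈ specializationKer n (formsIdeal g) := hle
    ⟨Ideal.mul_mem_right
      (Algebra.TensorProduct.includeRight y : ReesTensor n (formsIdeal g)) _
      (Ideal.subset_span (includeRight_mem_reesTensorBigrading n g hx)),
    Ideal.mul_mem_left _ _ (Ideal.subset_span (includeRight_mem_reesTensorBigrading n g hy))⟩
  rcases Ideal.IsPrime.mem_or_mem inferInstance hxy with h | h
  · rw [RingHom.mem_ker, specializationMap_includeRight] at h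
    have h0 := coeff_mem_of_reesReduction_eq_zero h 0
    rw [show (x : Polynomial (SourceRing k m r)) = Polynomial.C (MvPolynomial.X 0) from rfl,
      Polynomial.coeff_C_zero, mem_extendedIdeal_iff] at h0
    have h1 := h0 (Finsupp.single 0 1)
    rw [MvPolynomial.coeff_X, if_pos rfl] at h1
    exact Ideal.IsPrime.one_notMem ‹_› h1
  · rw [RingHom.mem_ker, specializationMap_includeRight] at h
    have h0 := coeff_mem_of_reesReduction_eq_zero h 1
    rw [Polynomial.coeff_monomial, if_pos rfl] at h0
    exact hj h0

theorem exists_specializationKer_localization_equiv [n.IsPrime]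
    (hI : specializedIdeal n (formsIdeal g) ≠ ⊥) :
    ∃ e : HomogeneousLocalization.AtPrime (reesTensorBigrading n g)
          (specializationKer n (formsIdeal g))
        ≃ₗ[HomogeneousLocalization.AtPrime (reesTensorBigrading n g)
          (specializationKer n (formsIdeal g))]
        moduleHomogeneousLocalization (reesTensorBigrading n g) (specializedReesBigrading n g)
          (specializationKer n (formsIdeal g)),
      ∀ (i : ℕ × ℕ) (a b : reesTensorBigrading n g i)
        (hb : b.val ∈ (specializationKer n (formsIdeal g)).primeCompl),
        (e (HomogeneousLocalization.mk ⟨i, a, b, hb⟩)).val =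
          LocalizedModule.mk (specializationMap n (formsIdeal g) a.val) ⟨b.val, hb⟩ := by
  have h1 : (1 : SourceRing k m r ⧸ extendedIdeal (SourceRing k m r) n) ∈
      specializedGrading r n ((0 : ℕ × ℕ).1 + (0 : ℕ × ℕ).2 * d) := by
    rw [Prod.fst_zero, Prod.snd_zero, zero_mul, add_zero]
    exact SetLike.GradedOne.one_mem
  refine exists_homogeneousLocalization_equiv (reesTensorBigrading n g)
    (specializedReesBigrading n g) _ ⟨1, h1, rfl⟩
    (fun i x hx => exists_mem_reesTensorBigrading n g hx) fun x hx => ?_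
  obtain ⟨a, ha, haP⟩ := exists_toReesTensor_notMem n (formsIdeal g) hI
  obtain ⟨N, hN⟩ := toReesTensor_pow_mul_eq_zero n (formsIdeal g) ha hx
  exact ⟨_, fun h => haP ((specializationKer_isPrime n (formsIdeal g)).mem_of_pow_mem _ h), hN⟩

end Setup

theorem mainTheorem9 {k : Type*} [Field k] {m r s d : ℕ} (hd : 0 < d) (α : Fin m → k)
    (g : Fin (s + 1) → Forms k m r d)
    (hI : specializedIdeal (pointIdeal α) (formsIdeal g) ≠ ⊥) :
    -- (i)
    (specializationKer (pointIdeal α) (formsIdeal g) ∈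
        minimalPrimes (ReesTensor (pointIdeal α) (formsIdeal g)) ∧
      (∃ e : (ReesTensor (pointIdeal α) (formsIdeal g) ⧸
            extensionToReesTensor (pointIdeal α) (formsIdeal g)) ≃+*
          AssocGradedTensor (pointIdeal α) (formsIdeal g),
        ∀ x, e (Ideal.Quotient.mk _ x) =
          reesTensorToAssocGraded (pointIdeal α) (formsIdeal g) x) ∧
      (∀ Q ∈ minimalPrimes (ReesTensor (pointIdeal α) (formsIdeal g)),
        Q ≠ specializationKer (pointIdeal α) (formsIdeal g) →
        (∃ q ∈ minimalPrimes (AssocGradedTensor (pointIdeal α) (formsIdeal g)),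
          q.comap (reesTensorToAssocGraded (pointIdeal α) (formsIdeal g)) = Q) ∧
        ringKrullDim (ReesTensor (pointIdeal α) (formsIdeal g) ⧸ Q) ≤
          ringKrullDim (AssocGradedTensor (pointIdeal α) (formsIdeal g))) ∧
      ringKrullDim (ReesTensor (pointIdeal α) (formsIdeal g)) =
        max ((r : WithBot ℕ∞) + 2)
          (ringKrullDim (AssocGradedTensor (pointIdeal α) (formsIdeal g)))) ∧
    -- (ii)
    (∀ l : ℕ,
      (∀ (P : Ideal (SourceRing k m r)) [P.IsPrime],
        formsIdeal g ≤ P → extendedIdeal (SourceRing k m r) (pointIdeal α) ≤ P →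
        analyticSpread ((formsIdeal g).map
            (algebraMap (SourceRing k m r) (Localization.AtPrime P))) ≤
          ((P.map (Ideal.Quotient.mk
            (extendedIdeal (SourceRing k m r) (pointIdeal α)))).height : WithBot ℕ∞) + l) →
      ringKrullDim (AssocGradedTensor (pointIdeal α) (formsIdeal g)) ≤
          ringKrullDim (SourceRing k m r ⧸ extendedIdeal (SourceRing k m r) (pointIdeal α)) + l ∧
        ringKrullDim (ReesTensor (pointIdeal α) (formsIdeal g)) ≤
          max ((r : WithBot ℕ∞) + 2) ((r : WithBot ℕ∞) + l + 1)) ∧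
    -- (iii)
    Module.supportDim (ReesTensor (pointIdeal α) (formsIdeal g))
        (specializationKer (pointIdeal α) (formsIdeal g)) ≤
      ringKrullDim (AssocGradedTensor (pointIdeal α) (formsIdeal g)) ∧
    -- (iv)
    IsBiProjPoint (reesTensorBigrading (pointIdeal α) g)
      (specializationKer (pointIdeal α) (formsIdeal g)) ∧
    ∃ _ : (specializationKer (pointIdeal α) (formsIdeal g)).IsPrime,
      ∃ e : HomogeneousLocalization.AtPrime (reesTensorBigrading (pointIdeal α) g)
            (specializationKer (pointIdeal α) (formsIdeal g))
          ≃ₗ[HomogeneousLocalization.AtPrime (reesTensorBigrading (pointIdeal α) g)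
            (specializationKer (pointIdeal α) (formsIdeal g))]
          moduleHomogeneousLocalization (reesTensorBigrading (pointIdeal α) g)
            (specializedReesBigrading (pointIdeal α) g)
            (specializationKer (pointIdeal α) (formsIdeal g)),
        ∀ (i : ℕ × ℕ) (a b : reesTensorBigrading (pointIdeal α) g i)
          (hb : b.val ∈ (specializationKer (pointIdeal α) (formsIdeal g)).primeCompl),
          (e (HomogeneousLocalization.mk ⟨i, a, b, hb⟩)).val =
            LocalizedModule.mk (specializationMap (pointIdeal α) (formsIdeal g) a.val)
              ⟨b.val, hb⟩ := by
  have hP : (specializationKer (pointIdeal α) (formsIdeal g)).IsPrime := inferInstance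
  have hT := ringKrullDim_reesTensor (pointIdeal α) (formsIdeal g)
  rw [ringKrullDim_specializedRees (pointIdeal α) hI] at hT
  refine ⟨⟨specializationKer_mem_minimalPrimes _ _ hI,
    ⟨quotientExtensionEquiv _ _, quotientExtensionEquiv_mk _ _⟩, fun Q hQ hne => ?_, hT⟩,
    fun l hl => ?_, supportDim_specializationKer_le _ _,
    specializationKer_isBiProjPoint _ g hI, hP,
    exists_specializationKer_localization_equiv _ g hI⟩
  · have hle := extensionToReesTensor_le_of_mem_minimalPrimes hQ hne
    exact ⟨exists_minimalPrimes_comap_eq (f := (reesTensorToAssocGraded _ _).toRingHom)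
        (reesTensorToAssocGraded_surjective _ _) hQ
        ((ker_reesTensorToAssocGraded _ _).trans_le hle),
      ringKrullDim_quotient_le_assocGraded hle⟩
  · have hG := ringKrullDim_assocGradedTensor_le (k := k) (pointIdeal α) (formsIdeal g) l hl
    refine ⟨hG, hT.trans_le (max_le_max le_rfl (hG.trans_eq ?_))⟩
    rw [ringKrullDim_specializedSource, add_right_comm]
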